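/- Let $M$ be a connected $C^\infty$ manifold of dimension $n=2$, $TM$ its tangent bundle and $T_0M=TM\setminus\{0\}$. A chart $(x^i)$ of $M$ induces coordinates $(x^i,y^i)$ on $TM$; let $J=\frac{\partial}{\partial y^i}\otimes dx^i$ be the tangent structure and $\mathbb C=y^i\frac{\partial}{\partial y^i}$ the Liouville vector field. Let $S$ be a spray, i.e. a smooth vector field on $T_0M$ with $JS=\mathbb C$ and $[\mathbb C,S]=S$. Put $$h=\tfrac12(\mathrm{Id}-\mathcal L_SJ),\qquad v=\tfrac12(\mathrm{Id}+\mathcal L_SJ),\qquad \Phi=v\circ\mathcal L_Sh=R^i_j\,\frac{\partial}{\partial y^i}\otimes dx^j ,$$ where $\Phi$ is the Jacobi endomorphism, $\operatorname{Ric}=\operatorname{Tr}\Phi=R^i_i$ is the Ricci curvature and $R=\operatorname{Ric}/(n-1)=\operatorname{Ric}$ is the Ricci scalar. For a vector-valued $1$-form $K$ put $d_K=i_Kd-d\,i_K$, so that $d_Kf=df\circ K$ on functions. Assume that $\operatorname{Ric}$ vanishes nowhere on $T_0M$ and that $S$ satisfies condition (A): $\operatorname{rank}\, d d_J(\operatorname{Tr}\Phi)=2n=4$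 everywhere on $T_0M$. Then: (i) $S$ is isotropic: there is a smooth semi-basic $1$-form $\alpha$ on $T_0M$ with $\Phi=R\,J-\alpha\otimes\mathbb C$. Its components, in any induced coordinates where $\alpha=\alpha_1dx^1+\alpha_2dx^2$, are $$\alpha_1=\frac{R^2_2}{y^1}=\frac{-R^2_1}{y^2},\qquad \alpha_2=\frac{-R^1_2}{y^1}=\frac{R^1_1}{y^2},$$ each quotient being asserted at the points where its denominator is non-zero. (ii) $S$ is metrizable by a Finsler function of non-zero constant curvature if and only if $d_J\alpha=0$ and $d_hR=0$ on $T_0M$. Here a Finsler function is a continuous $F:TM\to\mathbb R$, smooth and strictly positive on $T_0M$, with $F(x,\lambda y)=\lambda F(x,y)$ for all $\lambda\ge 0$, whose metric tensor $g_{ij}=\frac12\frac{\partial^2F^2}{\partial y^i\partial y^j}$ has rank $n$ on $T_0M$. It metrizes $S$ if $i_S\,dd_JF^2=-dF^2$ on $T_0M$, and it then has constant curvature $\kappa\in\mathbb R$ if $\Phi=\kappa\,(F^2J-F\,d_JF\otimes\mathbb C)$ on $T_0M$. -/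

import Mathlib

open scoped Manifold ContDiff

noncomputable section

namespace SprayGeometry

/-! ### Calculus on the coordinate space `(x, y) ∈ ℝⁿ × ℝⁿ` of an induced chart of `TM` -/

/-- The coordinate space `ℝⁿ`. -/
abbrev Euc (n : ℕ) := EuclideanSpace ℝ (Fin n)

/-- The coordinate space of points `(x, y)` of the tangent bundle; it is also the space of
tangent vectors `ξ = (ξ₁, ξ₂) = ξ₁ⁱ ∂/∂xⁱ + ξ₂ⁱ ∂/∂yⁱ` in induced coordinates. -/
abbrev Coord (n : ℕ) := Euc n × Euc n

variable {n : ℕ}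

/-- The tangent structure `J = ∂/∂yⁱ ⊗ dxⁱ`. -/
def tanJ (n : ℕ) : Coord n →L[ℝ] Coord n :=
  (ContinuousLinearMap.inr ℝ (Euc n) (Euc n)).comp (ContinuousLinearMap.fst ℝ (Euc n) (Euc n))

/-- The Liouville vector field `ℂ = yⁱ ∂/∂yⁱ`. -/
def liouville (z : Coord n) : Coord n := (0, z.2)

/-- The coordinate vector `∂/∂xⁱ`. -/
def dx (i : Fin n) : Coord n := (EuclideanSpace.single i 1, 0)

/-- Lie derivative of a field of endomorphisms: `(ℒ_S K)(X) = [S, K X] - K [S, X]`, evaluated on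
vector fields `X` with constant coefficients (it is tensorial in `X`). -/
def lieEnd (S : Coord n → Coord n) (K : Coord n → Coord n →L[ℝ] Coord n) (z : Coord n) :
    Coord n →L[ℝ] Coord n :=
  fderiv ℝ K z (S z) - (fderiv ℝ S z).comp (K z) + (K z).comp (fderiv ℝ S z)

/-- The horizontal projector `h = (Id - ℒ_S J) / 2`. -/
def horProj (S : Coord n → Coord n) (z : Coord n) : Coord n →L[ℝ] Coord n :=
  (1 / 2 : ℝ) • (ContinuousLinearMap.id ℝ (Coord n) - lieEnd S (fun _ => tanJ n) z)

/-- The vertical projector `v = (Id + ℒ_S J) / 2`. -/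
def verProj (S : Coord n → Coord n) (z : Coord n) : Coord n →L[ℝ] Coord n :=
  (1 / 2 : ℝ) • (ContinuousLinearMap.id ℝ (Coord n) + lieEnd S (fun _ => tanJ n) z)

/-- The Jacobi endomorphism `Φ = v ∘ ℒ_S h`. -/
def jacobiEnd (S : Coord n → Coord n) (z : Coord n) : Coord n →L[ℝ] Coord n :=
  (verProj S z).comp (lieEnd S (horProj S) z)

/-- The components of the Jacobi endomorphism, `Φ(∂/∂xʲ) = Rⁱ_j ∂/∂yⁱ`. -/
def jacobiComp (S : Coord n → Coord n) (z : Coord n) (i j : Fin n) : ℝ :=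
  (jacobiEnd S z (dx j)).2 i

/-- `d_K f = df ∘ K` for a function `f` and a field of endomorphisms `K`. -/
def dFun (K : Coord n → Coord n →L[ℝ] Coord n) (f : Coord n → ℝ) (z : Coord n) :
    Coord n →L[ℝ] ℝ :=
  (fderiv ℝ f z).comp (K z)

/-- Exterior derivative of a 1-form: `dθ(ξ, η) = (D_ξ θ)(η) - (D_η θ)(ξ)`. -/
def extD (θ : Coord n → Coord n →L[ℝ] ℝ) (z : Coord n) : Coord n →L[ℝ] Coord n →L[ℝ] ℝ :=
  fderiv ℝ θ z - (fderiv ℝ θ z).flip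

/-- `d_K θ = i_K dθ - d i_K θ` for a 1-form `θ` and a field of endomorphisms `K`, where
`(i_K ω)(ξ, η) = ω(K ξ, η) + ω(ξ, K η)` and `i_K θ = θ ∘ K`. -/
def dForm (K : Coord n → Coord n →L[ℝ] Coord n) (θ : Coord n → Coord n →L[ℝ] ℝ) (z : Coord n)
    (ξ η : Coord n) : ℝ :=
  extD θ z (K z ξ) η + extD θ z ξ (K z η) - extD (fun w => (θ w).comp (K w)) z ξ η

/-- The rank of a bilinear form (in particular of the value of a 2-form at a point). -/
def formRank (B : Coord n →L[ℝ] Coord n →L[ℝ] ℝ) : ℕ :=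
  Module.finrank ℝ (LinearMap.range (B : Coord n →ₗ[ℝ] (Coord n →L[ℝ] ℝ)))

/-- The matrix `g_ij = (1/2) ∂²(F²)/∂yⁱ∂yʲ` of a function `F` of `(x, y)`. -/
def metricTensor (F : Coord n → ℝ) (z : Coord n) : Matrix (Fin n) (Fin n) ℝ :=
  Matrix.of fun i j => (1 / 2 : ℝ) *
    fderiv ℝ (fun y => fderiv ℝ (fun y' => F (z.1, y') ^ 2) y (EuclideanSpace.single j 1)) z.2
      (EuclideanSpace.single i 1)

/-! ### The tangent bundle, its induced charts, and geometric objects on it -/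

variable {M : Type*} [TopologicalSpace M] [ChartedSpace (Euc n) M]

/-- The smooth charts of `M` (all those of the maximal atlas). -/
def smoothCharts (n : ℕ) (M : Type*) [TopologicalSpace M] [ChartedSpace (Euc n) M] :
    Set (OpenPartialHomeomorph M (Euc n)) :=
  IsManifold.maximalAtlas (𝓡 n) ∞ M

/-- The coordinate domain, inside `ℝⁿ × ℝⁿ`, of the chart of `T₀M` induced by the chart `e`. -/
def slitDomain (e : OpenPartialHomeomorph M (Euc n)) : Set (Coord n) :=
  {z | z.1 ∈ e.target ∧ z.2 ≠ 0}

variable [IsManifold (𝓡 n) ∞ M]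

/-- The slit tangent bundle `T₀M = TM \ {0}`. -/
def slitTangent (n : ℕ) (M : Type*) [TopologicalSpace M] [ChartedSpace (Euc n) M]
    [IsManifold (𝓡 n) ∞ M] : Set (TangentBundle (𝓡 n) M) :=
  {p | p.2 ≠ 0}

/-- The induced coordinates `(x, y)` on `TM` of a chart `e` of `M`. -/
def tcoord (e : OpenPartialHomeomorph M (Euc n)) (p : TangentBundle (𝓡 n) M) : Coord n :=
  (e p.1, mfderiv (𝓡 n) (𝓡 n) e p.1 p.2)

/-- The point of `TM` with induced coordinates `z = (x, y)`. -/
def tpoint (e : OpenPartialHomeomorph M (Euc n)) (z : Coord n) : TangentBundle (𝓡 n) M :=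
  ⟨e.symm z.1, mfderiv (𝓡 n) (𝓡 n) e.symm z.1 z.2⟩

/-- Vector fields on `TM`; only their values on `T₀M` will matter. -/
abbrev VField (n : ℕ) (M : Type*) [TopologicalSpace M] [ChartedSpace (Euc n) M]
    [IsManifold (𝓡 n) ∞ M] :=
  (p : TangentBundle (𝓡 n) M) → TangentSpace (𝓡 n).tangent p

/-- 1-forms on `TM`; only their values on `T₀M` will matter. -/
abbrev OneForm (n : ℕ) (M : Type*) [TopologicalSpace M] [ChartedSpace (Euc n) M]
    [IsManifold (𝓡 n) ∞ M] :=
  (p : TangentBundle (𝓡 n) M) → (TangentSpace (𝓡 n).tangent p →L[ℝ] ℝ)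

/-- Coordinate expression of a function on `TM`. -/
def locFun (e : OpenPartialHomeomorph M (Euc n)) (f : TangentBundle (𝓡 n) M → ℝ)
    (z : Coord n) : ℝ :=
  f (tpoint e z)

/-- Coordinate expression of a vector field on `TM`. -/
def locField (e : OpenPartialHomeomorph M (Euc n)) (S : VField n M) (z : Coord n) : Coord n :=
  mfderiv (𝓡 n).tangent 𝓘(ℝ, Coord n) (tcoord e) (tpoint e z) (S (tpoint e z))

/-- Coordinate expression of a 1-form on `TM`. -/
def locForm (e : OpenPartialHomeomorph M (Euc n)) (α : OneForm n M) (z : Coord n) :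
    Coord n →L[ℝ] ℝ :=
  (α (tpoint e z)).comp (mfderiv 𝓘(ℝ, Coord n) (𝓡 n).tangent (tpoint e) z)

/-- A spray: a smooth vector field `S` on `T₀M` with `J S = ℂ` and `[ℂ, S] = S`. -/
structure IsSpray (S : VField n M) : Prop where
  smooth : ContMDiffOn (𝓡 n).tangent (𝓡 n).tangent.tangent ∞
    (fun p => (⟨p, S p⟩ : TangentBundle (𝓡 n).tangent (TangentBundle (𝓡 n) M)))
    (slitTangent n M)
  tangent_apply : ∀ e ∈ smoothCharts n M, ∀ z ∈ slitDomain e,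
    tanJ n (locField e S z) = liouville z
  homogeneous : ∀ e ∈ smoothCharts n M, ∀ z ∈ slitDomain e,
    VectorField.lieBracket ℝ liouville (locField e S) z = locField e S z

/-- The Ricci curvature `Ric = Tr Φ = Rⁱ_i`, a function on `T₀M` (the trace does not depend on
the chart around the base point that is used to compute it). -/
def ricciCurvature (S : VField n M) (p : TangentBundle (𝓡 n) M) : ℝ :=
  ∑ i, jacobiComp (locField (chartAt (Euc n) p.1) S) (tcoord (chartAt (Euc n) p.1) p) i i

/-- The Ricci scalar `R`, given by `Ric = (n - 1) R`. -/
def ricciScalar (S : VField n M) (p : TangentBundle (𝓡 n) M) : ℝ :=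
  ricciCurvature S p / ((n : ℝ) - 1)

/-- The algebraic condition (A): `rank d d_J (Tr Φ) = 2n` on `T₀M`. -/
def ConditionA (S : VField n M) : Prop :=
  ∀ e ∈ smoothCharts n M, ∀ z ∈ slitDomain e,
    formRank (extD (dFun (fun _ => tanJ n) (locFun e (ricciCurvature S))) z) = 2 * n

/-- A smooth semi-basic 1-form on `T₀M`: one that vanishes on vertical vectors. -/
structure IsSemibasic (α : OneForm n M) : Prop where
  smooth : ∀ e ∈ smoothCharts n M, ContDiffOn ℝ ∞ (locForm e α) (slitDomain e)
  vertical : ∀ e ∈ smoothCharts n M, ∀ z ∈ slitDomain e, ∀ w : Euc n, locForm e α z (0, w) = 0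

/-- `α` is a semi-basic 1-form on `T₀M` for which `Φ = R J - α ⊗ ℂ`. -/
structure IsIsotropicWith (S : VField n M) (α : OneForm n M) : Prop where
  semibasic : IsSemibasic α
  jacobi : ∀ e ∈ smoothCharts n M, ∀ z ∈ slitDomain e,
    jacobiEnd (locField e S) z =
      locFun e (ricciScalar S) z • tanJ n - (locForm e α z).smulRight (liouville z)

/-- The spray `S` is isotropic. -/
def IsIsotropic (S : VField n M) : Prop := ∃ α : OneForm n M, IsIsotropicWith S α

/-- `d_J α = 0` on `T₀M`. -/
def DJClosed (α : OneForm n M) : Prop :=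
  ∀ e ∈ smoothCharts n M, ∀ z ∈ slitDomain e, ∀ ξ η : Coord n,
    dForm (fun _ => tanJ n) (locForm e α) z ξ η = 0

/-- `S` is Ricci constant: `d_h R = 0` on `T₀M`. -/
def RicciConstant (S : VField n M) : Prop :=
  ∀ e ∈ smoothCharts n M, ∀ z ∈ slitDomain e,
    dFun (horProj (locField e S)) (locFun e (ricciScalar S)) z = 0

/-- Finsler functions. -/
structure IsFinsler (F : TangentBundle (𝓡 n) M → ℝ) : Prop where
  continuous : Continuous F
  smooth : ContMDiffOn (𝓡 n).tangent 𝓘(ℝ, ℝ) ∞ F (slitTangent n M)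
  pos : ∀ p ∈ slitTangent n M, 0 < F p
  homogeneous : ∀ (x : M) (y : TangentSpace (𝓡 n) x) (c : ℝ), 0 ≤ c →
    F ⟨x, c • y⟩ = c * F ⟨x, y⟩
  regular : ∀ e ∈ smoothCharts n M, ∀ z ∈ slitDomain e,
    (metricTensor (locFun e F) z).rank = n

/-- `S` is the geodesic spray of `F`: `i_S d d_J F² = - dF²` on `T₀M`. -/
def IsGeodesicSpray (F : TangentBundle (𝓡 n) M → ℝ) (S : VField n M) : Prop :=
  ∀ e ∈ smoothCharts n M, ∀ z ∈ slitDomain e,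
    extD (dFun (fun _ => tanJ n) (fun w => locFun e F w ^ 2)) z (locField e S z) =
      - fderiv ℝ (fun w => locFun e F w ^ 2) z

/-- `F`, with geodesic spray `S`, has constant flag curvature `κ`:
`Φ = κ (F² J - F d_J F ⊗ ℂ)` on `T₀M`. -/
def HasConstantCurvature (F : TangentBundle (𝓡 n) M → ℝ) (S : VField n M) (κ : ℝ) : Prop :=
  ∀ e ∈ smoothCharts n M, ∀ z ∈ slitDomain e,
    jacobiEnd (locField e S) z =
      κ • (locFun e F z ^ 2 • tanJ n -
        (locFun e F z • dFun (fun _ => tanJ n) (locFun e F) z).smulRight (liouville z))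

/-- `S` is metrizable by a Finsler function of non-zero constant curvature. -/
def MetrizableNonzeroConstant (S : VField n M) : Prop :=
  ∃ F : TangentBundle (𝓡 n) M → ℝ, IsFinsler F ∧ IsGeodesicSpray F S ∧
    ∃ κ : ℝ, κ ≠ 0 ∧ HasConstantCurvature F S κ

end SprayGeometry

end

open SprayGeometry

open scoped Manifold ContDiff

noncomputable section

namespace SprayGeometry

set_option linter.unusedSectionVars false

/-! ### Induced coordinates on the tangent bundle. -/

section InducedCharts

variable {n : ℕ} {M : Type*} [TopologicalSpace M] [ChartedSpace (Euc n) M]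
  [IsManifold (𝓡 n) ∞ M] {e e' : OpenPartialHomeomorph M (Euc n)}

/-! Everything is computed in induced charts and glued by naturality. `Φ` takes vertical values and
kills vertical vectors and `S`, so `R^i_j y^j = 0`. A `2 × 2` matrix `A` with `A y = 0` has the
image of `tr A - A` inside the line `ℝ y`; this is isotropy on a surface
(`IsLocalSpray.jacobiEnd_eq`). Since `ℂ ≠ 0` on `T₀M`, the form `α` is determined by `Φ = R J - α ⊗
ℂ`. Hence its local expressions glue, and its components are read off entrywise.

If `F` metrizes `S` with curvature `κ`, the trace of `Φ` and Euler's identity give `R = κ F²`, hence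
`α = (κ/2) d_J F²`. Then `d_J α = 0` because `d_J d_J = 0`. The geodesic equation gives `S F² = 0`,
and differentiating this vertically turns the equation into `d_h F² = 0`, whence `d_h R = 0`.

Conversely put `F = √|R|`, so that `F² = ε R` with `ε = ±1`. This sign is constant because `M` and
the punctured tangent planes are connected. The identity `α(S) = R` and the degree-one homogeneity
of `α` turn `d_J α = 0` into `d_J R = 2 α` (`IsLocalSpray.fderiv_localRicci_tanJ`), so `Φ` has the
form required for constant curvature `κ = ε`. The equation `d_h R = 0` gives the geodesic equation
(`IsLocalSpray.extD_dFun_tanJ_spray`), and condition (A) makes the metric tensor regular. -/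

theorem mdifferentiable_of_mem_smoothCharts (he : e ∈ smoothCharts n M) :
    e.MDifferentiable (𝓡 n) (𝓡 n) :=
  ⟨(contMDiffOn_of_mem_maximalAtlas he).mdifferentiableOn (by simp),
    (contMDiffOn_symm_of_mem_maximalAtlas he).mdifferentiableOn (by simp)⟩

theorem tcoord_tpoint (he : e ∈ smoothCharts n M) {z : Coord n} (hz : z.1 ∈ e.target) :
    tcoord e (tpoint e z) = z := by
  refine Prod.ext (e.right_inv hz) ?_
  exact congrArg (fun L => L z.2) ((mdifferentiable_of_mem_smoothCharts he).comp_symm_deriv hz)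

theorem tpoint_tcoord (he : e ∈ smoothCharts n M) {p : TangentBundle (𝓡 n) M}
    (hp : p.1 ∈ e.source) : tpoint e (tcoord e p) = p := by
  obtain ⟨x, y⟩ := p
  have h := congrArg (fun L => L y)
    ((mdifferentiable_of_mem_smoothCharts he).symm_comp_deriv hp)
  have h1 : e.symm (e x) = x := e.left_inv hp
  simp only [tpoint, tcoord]
  rw [Bundle.TotalSpace.mk.injEq]
  exact ⟨h1, heq_of_eq h⟩

theorem contMDiff_bundleMk : ContMDiff 𝓘(ℝ, Coord n) (𝓡 n).tangent ∞
    (fun z : Coord n => (⟨z.1, z.2⟩ : TangentBundle (𝓡 n) (Euc n))) := by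
  intro z
  rw [Bundle.contMDiffAt_totalSpace]
  refine ⟨contDiff_fst.contMDiff.contMDiffAt, ?_⟩
  have : ContMDiffAt 𝓘(ℝ, Coord n) 𝓘(ℝ, Euc n) ∞ (fun z : Coord n => z.2) z :=
    contDiff_snd.contMDiff.contMDiffAt
  simpa using this

theorem contMDiffOn_tcoord (he : e ∈ smoothCharts n M) :
    ContMDiffOn (𝓡 n).tangent 𝓘(ℝ, Coord n) ∞ (tcoord e)
      (Bundle.TotalSpace.proj ⁻¹' e.source) := by
  have h1 := (contMDiffOn_of_mem_maximalAtlas he).contMDiffOn_tangentMapWithin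
    (m := ∞) (by simp) e.open_source.uniqueMDiffOn
  have h2 := (contMDiff_snd_tangentBundle_modelSpace (n := ∞) (Euc n) (𝓡 n)).comp_contMDiffOn h1
  have h3 : ContMDiffOn (𝓡 n).tangent 𝓘(ℝ, Euc n) ∞
      (fun p : TangentBundle (𝓡 n) M => e p.1) (Bundle.TotalSpace.proj ⁻¹' e.source) :=
    (contMDiffOn_of_mem_maximalAtlas he).comp
      (Bundle.contMDiff_proj (TangentSpace (𝓡 n) (M := M))).contMDiffOn (fun _ h => h)
  refine (h3.prodMk_space h2).congr fun p hp => ?_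
  refine Prod.ext rfl ?_
  change _ = mfderivWithin (𝓡 n) (𝓡 n) e e.source p.1 p.2
  rw [mfderivWithin_of_isOpen e.open_source hp]
  rfl

theorem contMDiffOn_tpoint (he : e ∈ smoothCharts n M) :
    ContMDiffOn 𝓘(ℝ, Coord n) (𝓡 n).tangent ∞ (tpoint e) {z | z.1 ∈ e.target} := by
  have h1 := (contMDiffOn_symm_of_mem_maximalAtlas he).contMDiffOn_tangentMapWithin
    (m := ∞) (by simp) e.open_target.uniqueMDiffOn
  have h2 := h1.comp (contMDiff_bundleMk (n := n)).contMDiffOn (Set.Subset.refl _)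
  refine h2.congr fun z hz => ?_
  change _ = (⟨e.symm z.1, mfderivWithin (𝓡 n) (𝓡 n) e.symm e.target z.1 z.2⟩ :
    TangentBundle (𝓡 n) M)
  rw [mfderivWithin_of_isOpen e.open_target hz]
  rfl

theorem isOpen_bundle_source (e : OpenPartialHomeomorph M (Euc n)) :
    IsOpen (Bundle.TotalSpace.proj ⁻¹' e.source : Set (TangentBundle (𝓡 n) M)) :=
  e.open_source.preimage (FiberBundle.continuous_proj (Euc n) (TangentSpace (𝓡 n) (M := M)))

theorem isOpen_coord_target (e : OpenPartialHomeomorph M (Euc n)) :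
    IsOpen {z : Coord n | z.1 ∈ e.target} :=
  e.open_target.preimage continuous_fst

theorem isOpen_slitDomain (e : OpenPartialHomeomorph M (Euc n)) : IsOpen (slitDomain e) :=
  (isOpen_coord_target e).inter (isOpen_ne.preimage continuous_snd)

theorem tcoord_smul (e : OpenPartialHomeomorph M (Euc n)) (x : M) (y : TangentSpace (𝓡 n) x)
    (c : ℝ) : tcoord e ⟨x, c • y⟩ = ((tcoord e ⟨x, y⟩).1, c • (tcoord e ⟨x, y⟩).2) :=
  Prod.ext rfl (map_smul (mfderiv (𝓡 n) (𝓡 n) e x) c y)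

theorem tcoord_snd_eq_zero_iff (he : e ∈ smoothCharts n M) {p : TangentBundle (𝓡 n) M}
    (hp : p.1 ∈ e.source) : (tcoord e p).2 = 0 ↔ p.2 = 0 := by
  have h := (mdifferentiable_of_mem_smoothCharts he).mfderiv_injective hp
  exact map_eq_zero_iff (mfderiv (𝓡 n) (𝓡 n) e p.1) h

theorem tcoord_mem_slitDomain (he : e ∈ smoothCharts n M) {p : TangentBundle (𝓡 n) M}
    (hp : p.1 ∈ e.source) (hp' : p ∈ slitTangent n M) : tcoord e p ∈ slitDomain e :=
  ⟨e.map_source hp, fun h => hp' ((tcoord_snd_eq_zero_iff he hp).1 h)⟩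

theorem tpoint_mem_source {z : Coord n} (hz : z.1 ∈ e.target) :
    (tpoint e z : TangentBundle (𝓡 n) M).1 ∈ e.source :=
  e.map_target hz

theorem tpoint_mem_slitTangent (he : e ∈ smoothCharts n M) {z : Coord n} (hz : z ∈ slitDomain e) :
    (tpoint e z : TangentBundle (𝓡 n) M) ∈ slitTangent n M := by
  intro h
  have := (tcoord_snd_eq_zero_iff he (tpoint_mem_source hz.1)).2 h
  rw [tcoord_tpoint he hz.1] at this
  exact hz.2 this

theorem tpoint_smul (e : OpenPartialHomeomorph M (Euc n)) (z : Coord n) (c : ℝ) :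
    (tpoint e (z.1, c • z.2) : TangentBundle (𝓡 n) M) = ⟨(tpoint e z).1, c • (tpoint e z).2⟩ := by
  have := map_smul (mfderiv (𝓡 n) (𝓡 n) e.symm z.1) c z.2
  exact congrArg (fun w => (⟨e.symm z.1, w⟩ : TangentBundle (𝓡 n) M)) this

theorem chartAt_mem_smoothCharts (x : M) : chartAt (Euc n) x ∈ smoothCharts n M :=
  IsManifold.chart_mem_maximalAtlas x

theorem mdifferentiableAt_tcoord (he : e ∈ smoothCharts n M) {p : TangentBundle (𝓡 n) M}
    (hp : p.1 ∈ e.source) :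
    MDifferentiableAt (𝓡 n).tangent 𝓘(ℝ, Coord n) (tcoord e) p :=
  ((contMDiffOn_tcoord he).contMDiffAt ((isOpen_bundle_source e).mem_nhds hp)).mdifferentiableAt
    (by simp)

theorem mdifferentiableAt_tpoint (he : e ∈ smoothCharts n M) {z : Coord n} (hz : z.1 ∈ e.target) :
    MDifferentiableAt 𝓘(ℝ, Coord n) (𝓡 n).tangent (tpoint e : Coord n → TangentBundle (𝓡 n) M) z :=
  ((contMDiffOn_tpoint he).contMDiffAt ((isOpen_coord_target e).mem_nhds hz)).mdifferentiableAt
    (by simp)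

end InducedCharts

/-! ### Changes of induced coordinates. -/

section Transition

variable {n : ℕ} {M : Type*} [TopologicalSpace M] [ChartedSpace (Euc n) M]
  [IsManifold (𝓡 n) ∞ M] {e e' : OpenPartialHomeomorph M (Euc n)}

/-- The change of induced coordinates on `TM` from the chart `e` to the chart `e'`. -/
def transition (e e' : OpenPartialHomeomorph M (Euc n)) (z : Coord n) : Coord n :=
  tcoord e' (tpoint e z : TangentBundle (𝓡 n) M)

/-- The points of `TM` over the intersection of two charts, in the coordinates of the first. -/
def overlap (e e' : OpenPartialHomeomorph M (Euc n)) : Set (Coord n) :=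
  {z | z.1 ∈ (e.symm.trans e').source}

theorem isOpen_overlap (e e' : OpenPartialHomeomorph M (Euc n)) : IsOpen (overlap e e') :=
  (e.symm.trans e').open_source.preimage continuous_fst

theorem overlap_fst {z : Coord n} (hz : z ∈ overlap e e') : z.1 ∈ e.target := by
  have : z.1 ∈ e.target ∧ e.symm z.1 ∈ e'.source := by simpa [overlap] using hz
  exact this.1

theorem overlap_snd {z : Coord n} (hz : z ∈ overlap e e') :
    (tpoint e z : TangentBundle (𝓡 n) M).1 ∈ e'.source := by
  have : z.1 ∈ e.target ∧ e.symm z.1 ∈ e'.source := by simpa [overlap] using hz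
  exact this.2

theorem mem_overlap {z : Coord n} (hz : z.1 ∈ e.target)
    (hz' : (tpoint e z : TangentBundle (𝓡 n) M).1 ∈ e'.source) : z ∈ overlap e e' := by
  have : z.1 ∈ e.target ∧ e.symm z.1 ∈ e'.source := ⟨hz, hz'⟩
  simpa [overlap] using this

theorem contDiffOn_transition (he : e ∈ smoothCharts n M) (he' : e' ∈ smoothCharts n M) :
    ContDiffOn ℝ ∞ (transition e e') (overlap e e') := by
  rw [← contMDiffOn_iff_contDiffOn]
  exact (contMDiffOn_tcoord he').comp ((contMDiffOn_tpoint he).mono fun _ h => overlap_fst h)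
    fun _ h => overlap_snd h

theorem contDiffAt_transition (he : e ∈ smoothCharts n M) (he' : e' ∈ smoothCharts n M)
    {z : Coord n} (hz : z ∈ overlap e e') : ContDiffAt ℝ ∞ (transition e e') z :=
  (contDiffOn_transition he he').contDiffAt ((isOpen_overlap e e').mem_nhds hz)

theorem tpoint_transition (he' : e' ∈ smoothCharts n M) {z : Coord n} (hz : z ∈ overlap e e') :
    tpoint e' (transition e e' z) = tpoint e z :=
  tpoint_tcoord he' (overlap_snd hz)

theorem transition_mem_slitDomain (he : e ∈ smoothCharts n M) (he' : e' ∈ smoothCharts n M)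
    {z : Coord n} (hz : z ∈ overlap e e') (hz' : z ∈ slitDomain e) :
    transition e e' z ∈ slitDomain e' :=
  tcoord_mem_slitDomain he' (overlap_snd hz) (tpoint_mem_slitTangent he hz')

theorem transition_transition (he : e ∈ smoothCharts n M) (he' : e' ∈ smoothCharts n M)
    {z : Coord n} (hz : z ∈ overlap e e') : transition e' e (transition e e' z) = z := by
  rw [transition, tpoint_transition he' hz, tcoord_tpoint he (overlap_fst hz)]

theorem fderiv_transition (he : e ∈ smoothCharts n M) (he' : e' ∈ smoothCharts n M)
    {z : Coord n} (hz : z ∈ overlap e e') :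
    fderiv ℝ (transition e e') z =
      (mfderiv (𝓡 n).tangent 𝓘(ℝ, Coord n) (tcoord e') (tpoint e z)).comp
        (mfderiv 𝓘(ℝ, Coord n) (𝓡 n).tangent (tpoint e) z) := by
  rw [← mfderiv_eq_fderiv]
  exact mfderiv_comp z (mdifferentiableAt_tcoord he' (overlap_snd hz))
    (mdifferentiableAt_tpoint he (overlap_fst hz))

/-- Chain rule for `tcoord e' = transition e e' ∘ tcoord e` near the point; it yields the
transformation law of vector fields. -/
theorem fderiv_transition_mfderiv_tcoord (he : e ∈ smoothCharts n M)
    (he' : e' ∈ smoothCharts n M) {z : Coord n} (hz : z ∈ overlap e e') :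
    (fderiv ℝ (transition e e') z).comp
        (mfderiv (𝓡 n).tangent 𝓘(ℝ, Coord n) (tcoord e) (tpoint e z)) =
      mfderiv (𝓡 n).tangent 𝓘(ℝ, Coord n) (tcoord e') (tpoint e z) := by
  set p : TangentBundle (𝓡 n) M := tpoint e z with hp
  have hpz : tcoord e p = z := tcoord_tpoint he (overlap_fst hz)
  have hpe : p.1 ∈ e.source := tpoint_mem_source (overlap_fst hz)
  have h1 : (tcoord e' : TangentBundle (𝓡 n) M → Coord n) =ᶠ[nhds p]
      transition e e' ∘ tcoord e := by
    filter_upwards [(isOpen_bundle_source e).mem_nhds hpe] with q hq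
    simp only [Function.comp, transition]
    rw [tpoint_tcoord he hq]
  have h2 : MDifferentiableAt 𝓘(ℝ, Coord n) 𝓘(ℝ, Coord n) (transition e e') (tcoord e p) := by
    rw [hpz]
    exact ((contDiffAt_transition he he' hz).differentiableAt (by simp)).mdifferentiableAt
  rw [h1.mfderiv_eq, mfderiv_comp p h2 (mdifferentiableAt_tcoord he hpe), hpz,
    mfderiv_eq_fderiv]
  rfl

theorem locField_transition (he : e ∈ smoothCharts n M) (he' : e' ∈ smoothCharts n M)
    (S : VField n M) {z : Coord n} (hz : z ∈ overlap e e') :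
    locField e' S (transition e e' z) = fderiv ℝ (transition e e') z (locField e S z) := by
  have h := congrArg (fun L => L (S (tpoint e z))) (fderiv_transition_mfderiv_tcoord he he' hz)
  have h2 : locField e' S (transition e e' z) =
      mfderiv (𝓡 n).tangent 𝓘(ℝ, Coord n) (tcoord e') (tpoint e z) (S (tpoint e z)) := by
    simp only [locField]
    rw [tpoint_transition he' hz]
  rw [h2]
  exact h.symm

/-- The derivative of a change of induced coordinates is block triangular, with equal diagonal
blocks. -/
theorem exists_fderiv_transition (he : e ∈ smoothCharts n M) (he' : e' ∈ smoothCharts n M)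
    {z : Coord n} (hz : z ∈ overlap e e') :
    ∃ A : Euc n →L[ℝ] Euc n, (transition e e' z).2 = A z.2 ∧
      (∀ ξ, (fderiv ℝ (transition e e') z ξ).1 = A ξ.1) ∧
      ∀ w, fderiv ℝ (transition e e') z (0, w) = (0, A w) := by
  have hd : DifferentiableAt ℝ (transition e e') z :=
    (contDiffAt_transition he he' hz).differentiableAt (by simp)
  have he1 := mdifferentiable_of_mem_smoothCharts he
  have he2 := mdifferentiable_of_mem_smoothCharts he'
  have hφ : MDifferentiableAt (𝓡 n) (𝓡 n) (e' ∘ e.symm) z.1 :=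
    (he2.mdifferentiableAt (overlap_snd hz)).comp z.1 (he1.mdifferentiableAt_symm (overlap_fst hz))
  have hm := mfderiv_comp z.1 (he2.mdifferentiableAt (overlap_snd hz))
    (he1.mdifferentiableAt_symm (overlap_fst hz))
  rw [mfderiv_eq_fderiv] at hm
  -- On a fibre the transition is linear in `y`, with the differential of `e' ∘ e.symm` as its
  -- linear map; this gives the vertical block.
  have hline : ∀ y, transition e e' (z.1, y) =
      (e' (e.symm z.1), fderiv ℝ (e' ∘ e.symm) z.1 y) := fun y =>
    Prod.ext rfl (congrArg (fun L => L y) hm).symm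
  refine ⟨fderiv ℝ (e' ∘ e.symm) z.1, congrArg Prod.snd (hline z.2), fun ξ => ?_, fun w => ?_⟩
  · have h1 : HasFDerivAt (fun w => (transition e e' w).1)
        ((ContinuousLinearMap.fst ℝ _ _).comp (fderiv ℝ (transition e e') z)) z :=
      hd.hasFDerivAt.fst
    have h2 : HasFDerivAt (fun w : Coord n => (e' ∘ e.symm) w.1)
        ((fderiv ℝ (e' ∘ e.symm) z.1).comp (ContinuousLinearMap.fst ℝ _ _)) z :=
      hφ.differentiableAt.hasFDerivAt.comp z hasFDerivAt_fst
    exact congrArg (fun L => L ξ) (h1.unique h2)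
  · have h1 : HasFDerivAt (fun y => transition e e' (z.1, y))
        ((fderiv ℝ (transition e e') z).comp (ContinuousLinearMap.inr ℝ (Euc n) (Euc n))) z.2 :=
      HasFDerivAt.comp (g := transition e e') (f := fun y => (z.1, y)) z.2 hd.hasFDerivAt
        (hasFDerivAt_prodMk_right z.1 z.2)
    have h2 : HasFDerivAt (fun y => transition e e' (z.1, y))
        ((0 : Euc n →L[ℝ] Euc n).prod (fderiv ℝ (e' ∘ e.symm) z.1)) z.2 := by
      have := (hasFDerivAt_const (𝕜 := ℝ) (e' (e.symm z.1)) z.2).prodMk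
        (fderiv ℝ (e' ∘ e.symm) z.1).hasFDerivAt
      exact this.congr_of_eventuallyEq (Filter.Eventually.of_forall hline)
    have := congrArg (fun L => L w) (h1.unique h2)
    simpa using this

end Transition

/-! ### Smoothness of the coordinate expression of a spray. -/

section Spray

variable {n : ℕ} {M : Type*} [TopologicalSpace M] [ChartedSpace (Euc n) M]
  [IsManifold (𝓡 n) ∞ M] {e : OpenPartialHomeomorph M (Euc n)} {S : VField n M}

/-- The coordinate expression is the fibre part of the tangent map of `tcoord e`, applied to the
section `S` along `tpoint e`. -/
theorem IsSpray.contDiffOn_locField (hS : IsSpray S) (he : e ∈ smoothCharts n M) :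
    ContDiffOn ℝ ∞ (locField e S) (slitDomain e) := by
  rw [← contMDiffOn_iff_contDiffOn]
  have h1 := (contMDiffOn_tcoord he).contMDiffOn_tangentMapWithin
    (m := ∞) (by simp) (isOpen_bundle_source e).uniqueMDiffOn
  have h2 := (contMDiff_snd_tangentBundle_modelSpace (n := ∞) (Coord n)
    𝓘(ℝ, Coord n)).comp_contMDiffOn h1
  have h0 : ContMDiffOn 𝓘(ℝ, Coord n) (𝓡 n).tangent ∞
      (tpoint e : Coord n → TangentBundle (𝓡 n) M) (slitDomain e) :=
    (contMDiffOn_tpoint he).mono fun _ h => h.1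
  have h3 := hS.smooth.comp h0 fun _ h => tpoint_mem_slitTangent he h
  have h4 := h2.comp h3 fun z h => tpoint_mem_source h.1
  refine h4.congr fun z hz => ?_
  change _ = mfderivWithin (𝓡 n).tangent 𝓘(ℝ, Coord n) (tcoord e) _ (tpoint e z) (S (tpoint e z))
  rw [mfderivWithin_of_isOpen (isOpen_bundle_source e) (tpoint_mem_source hz.1)]
  rfl

end Spray

/-! ### Naturality of the Lie derivative, the projectors and the Jacobi endomorphism. -/

section LieDerivative

variable {n : ℕ} {S S' ψ : Coord n → Coord n} {K K' : Coord n → Coord n →L[ℝ] Coord n}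
  {z : Coord n} {a b : ℝ}

theorem two_le_infty : (2 : WithTop ℕ∞) ≤ ∞ :=
  WithTop.coe_le_coe.2 (le_top : (2 : ℕ∞) ≤ ⊤)

theorem contDiffAt_fderiv_top {E F : Type*} [NormedAddCommGroup E] [NormedSpace ℝ E]
    [NormedAddCommGroup F] [NormedSpace ℝ F] {f : E → F} {x : E} (hf : ContDiffAt ℝ ∞ f x) :
    ContDiffAt ℝ ∞ (fderiv ℝ f) x :=
  hf.fderiv_right (by simp)

theorem contDiffAt_lieEnd (hS : ContDiffAt ℝ ∞ S z) (hK : ContDiffAt ℝ ∞ K z) :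
    ContDiffAt ℝ ∞ (lieEnd S K) z := by
  have h1 := contDiffAt_fderiv_top hS
  have h2 := contDiffAt_fderiv_top hK
  exact ((h2.clm_apply hS).sub (h1.clm_comp hK)).add (hK.clm_comp h1)

theorem contDiffAt_horProj (hS : ContDiffAt ℝ ∞ S z) : ContDiffAt ℝ ∞ (horProj S) z :=
  ContDiffAt.const_smul _ (contDiffAt_const.sub (contDiffAt_lieEnd hS contDiffAt_const))

theorem contDiffAt_verProj (hS : ContDiffAt ℝ ∞ S z) : ContDiffAt ℝ ∞ (verProj S) z :=
  ContDiffAt.const_smul _ (contDiffAt_const.add (contDiffAt_lieEnd hS contDiffAt_const))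

theorem contDiffAt_jacobiEnd (hS : ContDiffAt ℝ ∞ S z) : ContDiffAt ℝ ∞ (jacobiEnd S) z :=
  (contDiffAt_verProj hS).clm_comp (contDiffAt_lieEnd hS (contDiffAt_horProj hS))

/-- Naturality of the Lie derivative of endomorphisms under maps that relate the data up to
constant factors. -/
theorem lieEnd_related (hψ : ContDiffAt ℝ ∞ ψ z) (hS : DifferentiableAt ℝ S z)
    (hS' : DifferentiableAt ℝ S' (ψ z)) (hK : DifferentiableAt ℝ K z)
    (hK' : DifferentiableAt ℝ K' (ψ z))
    (hSS : ∀ᶠ w in nhds z, S' (ψ w) = a • fderiv ℝ ψ w (S w))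
    (hKK : ∀ᶠ w in nhds z, (K' (ψ w)).comp (fderiv ℝ ψ w) = b • (fderiv ℝ ψ w).comp (K w)) :
    (lieEnd S' K' (ψ z)).comp (fderiv ℝ ψ z) = (a * b) • (fderiv ℝ ψ z).comp (lieEnd S K z) := by
  have hψ1 : HasFDerivAt ψ (fderiv ℝ ψ z) z := (hψ.differentiableAt (by simp)).hasFDerivAt
  have hP : HasFDerivAt (fderiv ℝ ψ) (fderiv ℝ (fderiv ℝ ψ) z) z :=
    ((contDiffAt_fderiv_top hψ).differentiableAt (by simp)).hasFDerivAt
  have hsymm : ∀ u v, fderiv ℝ (fderiv ℝ ψ) z u v = fderiv ℝ (fderiv ℝ ψ) z v u :=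
    hψ.isSymmSndFDerivAt (by simpa using two_le_infty)
  set P := fderiv ℝ ψ with hPdef
  set Q := fderiv ℝ P z with hQ
  have hSz : S' (ψ z) = a • P z (S z) := hSS.self_of_nhds
  have hKz : ∀ η, K' (ψ z) (P z η) = b • P z (K z η) := fun η =>
    congrArg (fun L => L η) hKK.self_of_nhds
  -- `e1` and `e2` differentiate the two relations `hSS` and `hKK`. The second derivatives `Q` of
  -- `ψ` that appear cancel in the Lie derivative by `hsymm`.
  have e1 : ∀ u, fderiv ℝ S' (ψ z) (P z u) = a • (P z (fderiv ℝ S z u) + Q u (S z)) := by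
    intro u
    have h1 := hS'.hasFDerivAt.comp z hψ1
    have h2 := (hP.clm_apply hS.hasFDerivAt).const_smul a
    have h3 := h1.unique (h2.congr_of_eventuallyEq hSS)
    simpa using congrArg (fun L => L u) h3
  have e2 : ∀ u η, fderiv ℝ K' (ψ z) (P z u) (P z η) + K' (ψ z) (Q u η) =
      b • (P z (fderiv ℝ K z u η) + Q u (K z η)) := by
    intro u η
    have h1 := (hK'.hasFDerivAt.comp z hψ1).clm_apply (hP.clm_apply (hasFDerivAt_const η z))
    have h2 := (hP.clm_apply (hK.hasFDerivAt.clm_apply (hasFDerivAt_const η z))).const_smul b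
    have h3 := h1.unique (h2.congr_of_eventuallyEq (by
      filter_upwards [hKK] with w hw
      exact congrArg (fun L => L η) hw))
    have := congrArg (fun L => L u) h3
    simp only [add_apply, ContinuousLinearMap.comp_apply,
      ContinuousLinearMap.flip_apply, smul_apply,
      zero_apply, map_zero, zero_add, Function.comp_apply] at this
    rw [← this, add_comm]
  refine ContinuousLinearMap.ext fun η => ?_
  have hlie : lieEnd S' K' (ψ z) (P z η) = (a * b) • P z (lieEnd S K z η) := by
    simp only [lieEnd, add_apply, sub_apply,
      ContinuousLinearMap.comp_apply, map_add, map_sub]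
    have e3 := eq_sub_of_add_eq (e2 (S z) η)
    rw [hSz, map_smul, smul_apply, e3, hKz, map_smul, e1, e1, map_smul,
      map_add, hKz, hsymm η (S z), hsymm (K z η) (S z)]
    module
  simpa using hlie

/-- The factors `a` of `S` and `a⁻¹` of `J` cancel in `ℒ_S J`. The case `a = 1` serves coordinate
changes, the case `a = c` the fibrewise scaling by `c`. -/
theorem projections_related (hψ : ContDiffAt ℝ ∞ ψ z) (hS : DifferentiableAt ℝ S z)
    (hS' : DifferentiableAt ℝ S' (ψ z)) (ha : a ≠ 0)
    (hSS : ∀ᶠ w in nhds z, S' (ψ w) = a • fderiv ℝ ψ w (S w))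
    (hJ : ∀ᶠ w in nhds z, (tanJ n).comp (fderiv ℝ ψ w) = a⁻¹ • (fderiv ℝ ψ w).comp (tanJ n)) :
    (horProj S' (ψ z)).comp (fderiv ℝ ψ z) = (fderiv ℝ ψ z).comp (horProj S z) ∧
    (verProj S' (ψ z)).comp (fderiv ℝ ψ z) = (fderiv ℝ ψ z).comp (verProj S z) := by
  have h := lieEnd_related hψ hS hS' (differentiableAt_const (tanJ n))
    (differentiableAt_const (tanJ n)) hSS hJ
  rw [mul_inv_cancel₀ ha, one_smul] at h
  have h' : ∀ η, lieEnd S' (fun _ => tanJ n) (ψ z) (fderiv ℝ ψ z η) =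
      fderiv ℝ ψ z (lieEnd S (fun _ => tanJ n) z η) := fun η => congrArg (fun L => L η) h
  constructor
  · refine ContinuousLinearMap.ext fun η => ?_
    simp only [horProj, ContinuousLinearMap.comp_apply, smul_apply,
      sub_apply, h', map_smul, map_sub, ContinuousLinearMap.id_apply]
  · refine ContinuousLinearMap.ext fun η => ?_
    simp only [verProj, ContinuousLinearMap.comp_apply, smul_apply,
      add_apply, h', map_smul, map_add, ContinuousLinearMap.id_apply]

/-- Both projectors are preserved exactly, so the only factor `a` comes from the outer Lie
derivative along `S`. The relation for `h` is needed on a neighbourhood because it gets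
differentiated. -/
theorem jacobiEnd_related (hψ : ∀ᶠ w in nhds z, ContDiffAt ℝ ∞ ψ w)
    (hS : ∀ᶠ w in nhds z, ContDiffAt ℝ ∞ S w) (hS' : ∀ᶠ w in nhds (ψ z), ContDiffAt ℝ ∞ S' w)
    (ha : a ≠ 0) (hSS : ∀ᶠ w in nhds z, S' (ψ w) = a • fderiv ℝ ψ w (S w))
    (hJ : ∀ᶠ w in nhds z, (tanJ n).comp (fderiv ℝ ψ w) = a⁻¹ • (fderiv ℝ ψ w).comp (tanJ n))
    (ξ : Coord n) :
    jacobiEnd S' (ψ z) (fderiv ℝ ψ z ξ) = a • fderiv ℝ ψ z (jacobiEnd S z ξ) := by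
  have hSψ := hψ.self_of_nhds.continuousAt.eventually hS'
  have hh : ∀ᶠ w in nhds z, (horProj S' (ψ w)).comp (fderiv ℝ ψ w) =
      (1 : ℝ) • (fderiv ℝ ψ w).comp (horProj S w) := by
    filter_upwards [hψ, hS, hSψ, hSS.eventually_nhds, hJ.eventually_nhds] with w w1 w2 w3 h1 h2
    rw [one_smul]
    exact (projections_related w1 (w2.differentiableAt (by simp))
      (w3.differentiableAt (by simp)) ha h1 h2).1
  replace hψ := hψ.self_of_nhds
  replace hS := hS.self_of_nhds
  replace hS' := hS'.self_of_nhds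
  have hv := (projections_related hψ (hS.differentiableAt (by simp))
    (hS'.differentiableAt (by simp)) ha hSS hJ).2
  have hl := lieEnd_related hψ (hS.differentiableAt (by simp)) (hS'.differentiableAt (by simp))
    ((contDiffAt_horProj hS).differentiableAt (by simp))
    ((contDiffAt_horProj hS').differentiableAt (by simp)) hSS hh
  have hl' := congrArg (fun L => L ξ) hl
  simp only [ContinuousLinearMap.comp_apply, smul_apply, mul_one] at hl'
  have hv' := fun η => congrArg (fun L => L η) hv
  simp only [ContinuousLinearMap.comp_apply] at hv'
  simp only [jacobiEnd, ContinuousLinearMap.comp_apply]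
  rw [hl', map_smul, hv']

end LieDerivative

/-! ### Sprays in coordinates: homogeneity, projectors, curvature. -/

section LocalSpray

variable {n : ℕ}

/-- The part `y ≠ 0` of the coordinate space lying over `V`. -/
def slit (V : Set (Euc n)) : Set (Coord n) := {z | z.1 ∈ V ∧ z.2 ≠ 0}

/-- A spray in coordinates. -/
structure IsLocalSpray (V : Set (Euc n)) (S : Coord n → Coord n) : Prop where
  isOpen : IsOpen V
  smooth : ContDiffOn ℝ ∞ S (slit V)
  tangent_apply : ∀ z ∈ slit V, tanJ n (S z) = liouville z
  homogeneous : ∀ z ∈ slit V, VectorField.lieBracket ℝ liouville S z = S z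

/-- The Ricci curvature in coordinates. -/
def localRicci (S : Coord n → Coord n) (z : Coord n) : ℝ := ∑ i, jacobiComp S z i i

/-- The fibrewise scaling `(x, y) ↦ (x, c y)`. -/
def scaling (n : ℕ) (c : ℝ) : Coord n →L[ℝ] Coord n :=
  (ContinuousLinearMap.fst ℝ _ _).prod (c • ContinuousLinearMap.snd ℝ _ _)

@[simp] theorem scaling_apply (c : ℝ) (z : Coord n) : scaling n c z = (z.1, c • z.2) := rfl

@[simp] theorem tanJ_apply (z : Coord n) : tanJ n z = (0, z.1) := rfl

theorem hasFDerivAt_liouville (z : Coord n) :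
    HasFDerivAt liouville
      ((0 : Coord n →L[ℝ] Euc n).prod (ContinuousLinearMap.snd ℝ (Euc n) (Euc n))) z :=
  (hasFDerivAt_const (0 : Euc n) z).prodMk hasFDerivAt_snd

theorem isOpen_slit {V : Set (Euc n)} (hV : IsOpen V) : IsOpen (slit V) :=
  (hV.preimage continuous_fst).inter (isOpen_ne.preimage continuous_snd)

theorem scaling_mem_slit {V : Set (Euc n)} {z : Coord n} (hz : z ∈ slit V) {c : ℝ} (hc : c ≠ 0) :
    scaling n c z ∈ slit V :=
  ⟨hz.1, smul_ne_zero hc hz.2⟩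

/-- Euler's theorem on homogeneous functions, along a ray. -/
theorem eq_pow_smul_of_hasDerivAt {F : Type*} [NormedAddCommGroup F] [NormedSpace ℝ F]
    {f : ℝ → F} {f' : ℝ → F} (k : ℕ) (hf : ∀ t, 0 < t → HasDerivAt f (f' t) t)
    (h : ∀ t, 0 < t → t • f' t = (k : ℝ) • f t) {c : ℝ} (hc : 0 < c) : f c = c ^ k • f 1 := by
  -- The hypothesis says exactly that `t⁻ᵏ f(t)` has zero derivative on `(0, ∞)`.
  have hg : ∀ t, 0 < t → HasDerivAt (fun t => (t ^ k)⁻¹ • f t) 0 t := by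
    intro t ht
    have h1 := ((hasDerivAt_pow k t).inv (pow_ne_zero k ht.ne')).smul (hf t ht)
    refine h1.congr_deriv ?_
    have h2 : f' t = t⁻¹ • (k : ℝ) • f t := by
      rw [← h t ht, smul_smul, inv_mul_cancel₀ ht.ne', one_smul]
    rw [h2, smul_smul, smul_smul, ← add_smul]
    convert zero_smul ℝ (f t)
    rcases k with _ | k
    · simp
    · simp only [Nat.add_sub_cancel, Pi.inv_apply]
      field_simp
      ring
  have hconst := isOpen_Ioi.is_const_of_deriv_eq_zero (isPreconnected_Ioi (a := (0 : ℝ)))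
    (fun t ht => (hg t ht).differentiableAt.differentiableWithinAt)
    (fun t ht => (hg t ht).deriv) (Set.mem_Ioi.2 hc) (Set.mem_Ioi.2 one_pos)
  have h3 : (c ^ k)⁻¹ • f c = f 1 := by simpa using hconst
  rw [← h3, smul_smul, mul_inv_cancel₀ (pow_ne_zero k hc.ne'), one_smul]

namespace IsLocalSpray

variable {V : Set (Euc n)} {S : Coord n → Coord n} {z : Coord n}

theorem mem_nhds (hS : IsLocalSpray V S) (hz : z ∈ slit V) : slit V ∈ nhds z :=
  (isOpen_slit hS.isOpen).mem_nhds hz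

theorem contDiffAt (hS : IsLocalSpray V S) (hz : z ∈ slit V) : ContDiffAt ℝ ∞ S z :=
  hS.smooth.contDiffAt (hS.mem_nhds hz)

theorem differentiableAt (hS : IsLocalSpray V S) (hz : z ∈ slit V) : DifferentiableAt ℝ S z :=
  (hS.contDiffAt hz).differentiableAt (by simp)

theorem fst_eq (hS : IsLocalSpray V S) (hz : z ∈ slit V) : (S z).1 = z.2 :=
  congrArg Prod.snd (hS.tangent_apply z hz)

theorem fderiv_fst (hS : IsLocalSpray V S) (hz : z ∈ slit V) (ξ : Coord n) :
    (fderiv ℝ S z ξ).1 = ξ.2 := by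
  have h1 : HasFDerivAt (fun w => (S w).1)
      ((ContinuousLinearMap.fst ℝ _ _).comp (fderiv ℝ S z)) z :=
    (hS.differentiableAt hz).hasFDerivAt.fst
  have h2 : HasFDerivAt (fun w : Coord n => w.2) (ContinuousLinearMap.snd ℝ _ _) z :=
    hasFDerivAt_snd
  have h3 := h1.unique (h2.congr_of_eventuallyEq (by
    filter_upwards [hS.mem_nhds hz] with w hw using hS.fst_eq hw))
  exact congrArg (fun L => L ξ) h3

/-- `[ℂ, S] = S` written out; the second component is Euler's identity of degree two for the spray
coefficients. -/
theorem fderiv_liouville (hS : IsLocalSpray V S) (hz : z ∈ slit V) :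
    fderiv ℝ S z (0, z.2) = (z.2, (2 : ℝ) • (S z).2) := by
  have h := hS.homogeneous z hz
  rw [VectorField.lieBracket, (hasFDerivAt_liouville z).fderiv] at h
  have h2 : fderiv ℝ S z (0, z.2) = S z + (0, (S z).2) := by
    rw [sub_eq_iff_eq_add] at h
    simpa [liouville] using h
  rw [h2]
  refine Prod.ext ?_ ?_
  · simp [hS.fst_eq hz]
  · simp [two_smul]

theorem apply_scaling (hS : IsLocalSpray V S) (hz : z ∈ slit V) {c : ℝ} (hc : 0 < c) :
    S (scaling n c z) = c • scaling n c (S z) := by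
  have hmem : ∀ t : ℝ, 0 < t → scaling n t z ∈ slit V := fun t ht => scaling_mem_slit hz ht.ne'
  have hline : ∀ t : ℝ, HasDerivAt (fun t => scaling n t z) (0, z.2) t := fun t => by
    have := ((hasDerivAt_id t).smul_const z.2)
    simpa using (hasDerivAt_const t z.1).prodMk this
  have key := eq_pow_smul_of_hasDerivAt (f := fun t => (S (scaling n t z)).2)
    (f' := fun t => (fderiv ℝ S (scaling n t z) (0, z.2)).2) 2
    (fun t ht => (ContinuousLinearMap.snd ℝ (Euc n) (Euc n)).hasFDerivAt.comp_hasDerivAt t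
      ((hS.differentiableAt (hmem t ht)).hasFDerivAt.comp_hasDerivAt t (hline t)))
    (fun t ht => by
      have := congrArg Prod.snd (hS.fderiv_liouville (hmem t ht))
      have h2 : ((0, t • z.2) : Coord n) = t • (0, z.2) := by simp
      rw [scaling_apply, h2, map_smul] at this
      simpa using this) hc
  refine Prod.ext ?_ ?_
  · rw [hS.fst_eq (hmem c hc)]
    simp [hS.fst_eq hz]
  · rw [key]
    simp [smul_smul, pow_two]

theorem lieEnd_tanJ (hS : IsLocalSpray V S) (hz : z ∈ slit V) (ξ : Coord n) :
    lieEnd S (fun _ => tanJ n) z ξ = (-ξ.1, ξ.2 - (fderiv ℝ S z (0, ξ.1)).2) := by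
  have h := hS.fderiv_fst hz
  simp only [lieEnd, fderiv_fun_const, Pi.zero_apply, zero_apply, zero_sub, add_apply, neg_apply,
    ContinuousLinearMap.comp_apply, tanJ_apply, h]
  refine Prod.ext ?_ ?_
  · simp [h]
  · simp only [Prod.snd_add, Prod.snd_neg]
    abel

theorem horProj_apply (hS : IsLocalSpray V S) (hz : z ∈ slit V) (ξ : Coord n) :
    horProj S z ξ = (ξ.1, (1 / 2 : ℝ) • (fderiv ℝ S z (0, ξ.1)).2) := by
  simp only [horProj, smul_apply, sub_apply, ContinuousLinearMap.id_apply, hS.lieEnd_tanJ hz]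
  refine Prod.ext ?_ ?_
  · simp only [Prod.smul_fst, Prod.fst_sub]
    module
  · simp

theorem verProj_apply (hS : IsLocalSpray V S) (hz : z ∈ slit V) (ξ : Coord n) :
    verProj S z ξ = (0, ξ.2 - (1 / 2 : ℝ) • (fderiv ℝ S z (0, ξ.1)).2) := by
  simp only [verProj, smul_apply, add_apply, ContinuousLinearMap.id_apply, hS.lieEnd_tanJ hz]
  refine Prod.ext ?_ ?_
  · simp
  · simp only [Prod.smul_snd, Prod.snd_add]
    module

theorem verProj_horProj (hS : IsLocalSpray V S) (hz : z ∈ slit V) (ξ : Coord n) :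
    verProj S z (horProj S z ξ) = 0 := by
  rw [hS.verProj_apply hz, hS.horProj_apply hz]
  simp

/-- The fibre component of `S` has degree two, so half its derivative along `ℂ` is itself. -/
theorem horProj_spray (hS : IsLocalSpray V S) (hz : z ∈ slit V) : horProj S z (S z) = S z := by
  rw [hS.horProj_apply hz, hS.fst_eq hz, hS.fderiv_liouville hz]
  refine Prod.ext (hS.fst_eq hz).symm ?_
  simp [smul_smul]

theorem jacobiEnd_fst (hS : IsLocalSpray V S) (hz : z ∈ slit V) (ξ : Coord n) :
    (jacobiEnd S z ξ).1 = 0 := by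
  simp only [jacobiEnd, ContinuousLinearMap.comp_apply, hS.verProj_apply hz]

theorem fderiv_horProj_vertical (hS : IsLocalSpray V S) (hz : z ∈ slit V) (u : Coord n)
    (w : Euc n) : fderiv ℝ (horProj S) z u (0, w) = 0 := by
  have h1 := (((contDiffAt_horProj (hS.contDiffAt hz)).differentiableAt
    (by simp)).hasFDerivAt).clm_apply (hasFDerivAt_const ((0, w) : Coord n) z)
  have h2 : HasFDerivAt (fun _ : Coord n => (0 : Coord n)) (0 : Coord n →L[ℝ] Coord n) z :=
    hasFDerivAt_const _ _
  have h3 := h1.unique (h2.congr_of_eventuallyEq (by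
    filter_upwards [hS.mem_nhds hz] with v hv
    rw [hS.horProj_apply hv]
    have : ((0, (0 : Euc n)) : Coord n) = 0 := rfl
    simp [this]))
  simpa using congrArg (fun L => L u) h3

/-- As `h` vanishes on vertical vectors identically, `(ℒ_S h)(0, w)` reduces to a value of `h`,
which `v` kills. -/
theorem jacobiEnd_vertical (hS : IsLocalSpray V S) (hz : z ∈ slit V) (w : Euc n) :
    jacobiEnd S z (0, w) = 0 := by
  have h0 : horProj S z (0, w) = 0 := by
    rw [hS.horProj_apply hz]
    have : ((0, (0 : Euc n)) : Coord n) = 0 := rfl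
    simp [this]
  simp only [jacobiEnd, lieEnd, ContinuousLinearMap.comp_apply, add_apply, sub_apply,
    hS.fderiv_horProj_vertical hz, h0, map_zero, sub_zero, zero_add, hS.verProj_horProj hz]

theorem jacobiEnd_eq_of_fst_eq (hS : IsLocalSpray V S) (hz : z ∈ slit V) {ξ η : Coord n}
    (h : ξ.1 = η.1) : jacobiEnd S z ξ = jacobiEnd S z η := by
  have : ξ - η = (0, ξ.2 - η.2) := Prod.ext (sub_eq_zero.2 h) rfl
  rw [← sub_eq_zero, ← map_sub, this, hS.jacobiEnd_vertical hz]

/-- Differentiating `h S = S` along `S` gives `(ℒ_S h) S = [S, h S] - h [S, S] = 0`. -/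
theorem jacobiEnd_spray (hS : IsLocalSpray V S) (hz : z ∈ slit V) : jacobiEnd S z (S z) = 0 := by
  have h1 := (((contDiffAt_horProj (hS.contDiffAt hz)).differentiableAt
    (by simp)).hasFDerivAt).clm_apply (hS.differentiableAt hz).hasFDerivAt
  have h2 := h1.unique ((hS.differentiableAt hz).hasFDerivAt.congr_of_eventuallyEq (by
    filter_upwards [hS.mem_nhds hz] with v hv using hS.horProj_spray hv))
  have h3 := congrArg (fun L => L (S z)) h2
  simp only [add_apply, ContinuousLinearMap.comp_apply, ContinuousLinearMap.flip_apply] at h3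
  simp only [jacobiEnd, lieEnd, ContinuousLinearMap.comp_apply, add_apply, sub_apply,
    hS.horProj_spray hz]
  rw [eq_sub_of_add_eq' h3]
  simp

theorem jacobiEnd_scaling (hS : IsLocalSpray V S) (hz : z ∈ slit V) {c : ℝ} (hc : 0 < c)
    (ξ : Coord n) :
    jacobiEnd S (scaling n c z) (scaling n c ξ) = c • scaling n c (jacobiEnd S z ξ) := by
  have hd : ∀ w, fderiv ℝ (scaling n c) w = scaling n c := fun w => (scaling n c).fderiv
  have h := jacobiEnd_related (ψ := scaling n c) (S := S) (S' := S) (z := z) (a := c)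
    (Filter.Eventually.of_forall fun w => (scaling n c).contDiff.contDiffAt)
    (by filter_upwards [hS.mem_nhds hz] with w hw using hS.contDiffAt hw)
    (by
      filter_upwards [hS.mem_nhds (scaling_mem_slit hz hc.ne')] with w hw using hS.contDiffAt hw)
    hc.ne'
    (by
      filter_upwards [hS.mem_nhds hz] with w hw
      rw [hd, hS.apply_scaling hw hc])
    (Filter.Eventually.of_forall fun w => by
      rw [hd]
      refine ContinuousLinearMap.ext fun η => ?_
      simp [smul_smul, inv_mul_cancel₀ hc.ne'])
    ξ
  rwa [hd] at h

/-- Only the `x`-part of the argument matters, and scaling leaves it alone; so the components of `Φ`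
have degree two in `y`. -/
theorem jacobiEnd_scaling_snd (hS : IsLocalSpray V S) (hz : z ∈ slit V) {c : ℝ} (hc : 0 < c)
    (ξ : Coord n) :
    (jacobiEnd S (scaling n c z) ξ).2 = c ^ 2 • (jacobiEnd S z ξ).2 := by
  rw [hS.jacobiEnd_eq_of_fst_eq (scaling_mem_slit hz hc.ne')
    (ξ := ξ) (η := scaling n c ξ) rfl,
    hS.jacobiEnd_scaling hz hc]
  simp [smul_smul, pow_two]

theorem localRicci_scaling (hS : IsLocalSpray V S) (hz : z ∈ slit V) {c : ℝ} (hc : 0 < c) :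
    localRicci S (scaling n c z) = c ^ 2 * localRicci S z := by
  simp only [localRicci, jacobiComp, Finset.mul_sum, hS.jacobiEnd_scaling_snd hz hc]
  simp

theorem contDiffAt_localRicci (hS : IsLocalSpray V S) (hz : z ∈ slit V) :
    ContDiffAt ℝ ∞ (localRicci S) z := by
  refine ContDiffAt.sum fun i _ => ?_
  have h1 : ContDiffAt ℝ ∞ (fun w => (jacobiEnd S w (dx i)).2) z :=
    ((contDiffAt_jacobiEnd (hS.contDiffAt hz)).clm_apply contDiffAt_const).snd
  exact (contDiff_euclidean.1 (contDiff_id (E := Euc n)) i).contDiffAt.comp z h1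

end IsLocalSpray

end LocalSpray

/-! ### Independence of the chart. -/

section Invariance

variable {n : ℕ} {M : Type*} [TopologicalSpace M] [ChartedSpace (Euc n) M]
  [IsManifold (𝓡 n) ∞ M] {e e' : OpenPartialHomeomorph M (Euc n)} {S : VField n M}

theorem IsSpray.isLocalSpray (hS : IsSpray S) (he : e ∈ smoothCharts n M) :
    IsLocalSpray e.target (locField e S) :=
  ⟨e.open_target, hS.contDiffOn_locField he, hS.tangent_apply e he, hS.homogeneous e he⟩

theorem tanJ_comp_fderiv_transition (he : e ∈ smoothCharts n M) (he' : e' ∈ smoothCharts n M)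
    {z : Coord n} (hz : z ∈ overlap e e') (ξ : Coord n) :
    tanJ n (fderiv ℝ (transition e e') z ξ) = fderiv ℝ (transition e e') z (tanJ n ξ) := by
  obtain ⟨A, -, h1, h2⟩ := exists_fderiv_transition he he' hz
  rw [tanJ_apply, tanJ_apply, h1, h2]

theorem fderiv_transition_liouville (he : e ∈ smoothCharts n M) (he' : e' ∈ smoothCharts n M)
    {z : Coord n} (hz : z ∈ overlap e e') :
    fderiv ℝ (transition e e') z (liouville z) = liouville (transition e e' z) := by
  obtain ⟨A, h0, -, h2⟩ := exists_fderiv_transition he he' hz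
  rw [liouville, liouville, h2, h0]

theorem jacobiEnd_transition (hS : IsSpray S) (he : e ∈ smoothCharts n M)
    (he' : e' ∈ smoothCharts n M) {z : Coord n} (hz : z ∈ overlap e e') (hz' : z ∈ slitDomain e)
    (ξ : Coord n) :
    jacobiEnd (locField e' S) (transition e e' z) (fderiv ℝ (transition e e') z ξ) =
      fderiv ℝ (transition e e') z (jacobiEnd (locField e S) z ξ) := by
  have hn := (isOpen_overlap e e').mem_nhds hz
  have h1 := (hS.isLocalSpray he).mem_nhds hz'
  have h2 := (hS.isLocalSpray he').mem_nhds (transition_mem_slitDomain he he' hz hz')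
  have h := jacobiEnd_related (ψ := transition e e') (S := locField e S) (S' := locField e' S)
    (z := z) (a := 1)
    (by filter_upwards [hn] with w hw using contDiffAt_transition he he' hw)
    (by filter_upwards [h1] with w hw using (hS.isLocalSpray he).contDiffAt hw)
    (by filter_upwards [h2] with w hw using (hS.isLocalSpray he').contDiffAt hw)
    one_ne_zero
    (by
      filter_upwards [hn] with w hw
      rw [one_smul, locField_transition he he' S hw])
    (by
      filter_upwards [hn] with w hw
      refine ContinuousLinearMap.ext fun η => ?_
      simpa using tanJ_comp_fderiv_transition he he' hw η)
    ξ
  rwa [one_smul] at h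

/-- The Jacobi endomorphism, as an endomorphism `Rⁱ_j` of `ℝⁿ`. -/
def curvatureMap (S : Coord n → Coord n) (z : Coord n) : Euc n →ₗ[ℝ] Euc n :=
  (ContinuousLinearMap.snd ℝ (Euc n) (Euc n)).comp
    ((jacobiEnd S z).comp (ContinuousLinearMap.inl ℝ (Euc n) (Euc n)))

theorem localRicci_eq_trace (S : Coord n → Coord n) (z : Coord n) :
    localRicci S z = LinearMap.trace ℝ (Euc n) (curvatureMap S z) := by
  rw [LinearMap.trace_eq_matrix_trace ℝ (EuclideanSpace.basisFun (Fin n) ℝ).toBasis,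
    Matrix.trace, localRicci]
  refine Finset.sum_congr rfl fun i _ => ?_
  simp [jacobiComp, LinearMap.toMatrix_apply, curvatureMap, dx]

/-- The curvature matrices in two charts are conjugate under the Jacobian `A` of the change of base
coordinates, so their traces agree. -/
theorem localRicci_transition (hS : IsSpray S) (he : e ∈ smoothCharts n M)
    (he' : e' ∈ smoothCharts n M) {z : Coord n} (hz : z ∈ overlap e e') (hz' : z ∈ slitDomain e) :
    localRicci (locField e' S) (transition e e' z) = localRicci (locField e S) z := by
  obtain ⟨A, -, hA, hA'⟩ := exists_fderiv_transition he he' hz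
  have hw : transition e e' z ∈ overlap e' e :=
    mem_overlap (e'.map_source (overlap_snd hz))
      (by rw [tpoint_transition he' hz]; exact tpoint_mem_source (overlap_fst hz))
  obtain ⟨B, -, hB, -⟩ := exists_fderiv_transition he' he hw
  have hinv : (fderiv ℝ (transition e' e) (transition e e' z)).comp
      (fderiv ℝ (transition e e') z) = ContinuousLinearMap.id ℝ _ := by
    have h1 := (((contDiffAt_transition he' he hw).differentiableAt (by simp)).hasFDerivAt).comp z
      ((contDiffAt_transition he he' hz).differentiableAt (by simp)).hasFDerivAt
    refine h1.unique ((hasFDerivAt_id z).congr_of_eventuallyEq ?_)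
    filter_upwards [(isOpen_overlap e e').mem_nhds hz] with w hw
    exact transition_transition he he' hw
  have hBA : (B : Euc n →ₗ[ℝ] Euc n) * (A : Euc n →ₗ[ℝ] Euc n) = 1 := by
    refine LinearMap.ext fun v => ?_
    have := congrArg (fun L => (L ((v, 0) : Coord n)).1) hinv
    simpa [hB, hA] using this
  have hAB := mul_eq_one_comm.1 hBA
  have hRA : curvatureMap (locField e' S) (transition e e' z) * (A : Euc n →ₗ[ℝ] Euc n) =
      (A : Euc n →ₗ[ℝ] Euc n) * curvatureMap (locField e S) z := by
    refine LinearMap.ext fun v => ?_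
    have h1 := jacobiEnd_transition hS he he' hz hz' (v, 0)
    have h2 : jacobiEnd (locField e S) z (v, 0) =
        (0, (jacobiEnd (locField e S) z (v, 0)).2) :=
      Prod.ext ((hS.isLocalSpray he).jacobiEnd_fst hz' _) rfl
    rw [h2, hA', (hS.isLocalSpray he').jacobiEnd_eq_of_fst_eq
      (transition_mem_slitDomain he he' hz hz') (η := (A v, 0)) (hA _)] at h1
    simpa [curvatureMap] using congrArg Prod.snd h1
  rw [localRicci_eq_trace, localRicci_eq_trace,
    ← mul_one (curvatureMap (locField e' S) (transition e e' z)), ← hAB, ← mul_assoc, hRA,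
    mul_assoc, LinearMap.trace_mul_comm, mul_assoc, hBA, mul_one]

/-- Replaces the preferred chart at the base point, used to define `Ric`, by an arbitrary smooth
chart. -/
theorem locFun_ricciCurvature (hS : IsSpray S) (he : e ∈ smoothCharts n M) {z : Coord n}
    (hz : z ∈ slitDomain e) : locFun e (ricciCurvature S) z = localRicci (locField e S) z :=
  localRicci_transition hS he (chartAt_mem_smoothCharts _)
    (mem_overlap hz.1 (mem_chart_source _ _)) hz

end Invariance

/-! ### Every spray on a surface is isotropic. -/

section Surface

/-- The form `α` with `Φ = R J - α ⊗ ℂ` of a spray on a surface, in coordinates. -/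
def localIsoForm (S : Coord 2 → Coord 2) (z : Coord 2) : Coord 2 →L[ℝ] ℝ :=
  (‖z.2‖ ^ 2)⁻¹ • (localRicci S z • (innerSL ℝ z.2).comp (ContinuousLinearMap.fst ℝ _ _) -
    (innerSL ℝ z.2).comp ((ContinuousLinearMap.snd ℝ _ _).comp (jacobiEnd S z)))

variable {V : Set (Euc 2)} {S : Coord 2 → Coord 2} {z : Coord 2}

theorem IsLocalSpray.jacobiEnd_snd_apply (hS : IsLocalSpray V S) (hz : z ∈ slit V) (ξ : Coord 2)
    (i : Fin 2) :
    (jacobiEnd S z ξ).2 i = jacobiComp S z i 0 * ξ.1 0 + jacobiComp S z i 1 * ξ.1 1 := by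
  have h : jacobiEnd S z ξ = jacobiEnd S z (ξ.1 0 • dx 0 + ξ.1 1 • dx 1) := by
    refine hS.jacobiEnd_eq_of_fst_eq hz ?_
    ext j
    fin_cases j <;> simp [dx]
  rw [h]
  simp [jacobiComp, mul_comm]

/-- The curvature matrix kills `y` because `Φ(S) = 0`, so in dimension two `R J - Φ` takes values in
the line of `ℂ`. The Euclidean inner product with `y`, divided by `‖y‖²`, extracts the coefficient.
-/
theorem IsLocalSpray.jacobiEnd_eq (hS : IsLocalSpray V S) (hz : z ∈ slit V) :
    jacobiEnd S z =
      localRicci S z • tanJ 2 - (localIsoForm S z).smulRight (liouville z) := by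
  have hy : ∀ i, jacobiComp S z i 0 * z.2 0 + jacobiComp S z i 1 * z.2 1 = 0 := fun i => by
    have := hS.jacobiEnd_snd_apply hz (S z) i
    rw [hS.jacobiEnd_spray hz, hS.fst_eq hz] at this
    simpa using this.symm
  have hN : ‖z.2‖ ^ 2 = z.2 0 ^ 2 + z.2 1 ^ 2 := by
    rw [EuclideanSpace.norm_sq_eq]
    simp
  have hN0 : z.2 0 ^ 2 + z.2 1 ^ 2 ≠ 0 := by
    rw [← hN]
    exact pow_ne_zero 2 (norm_ne_zero_iff.2 hz.2)
  have hin : ∀ v : Euc 2, innerSL ℝ z.2 v = z.2 0 * v 0 + z.2 1 * v 1 := fun v => by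
    simp [PiLp.inner_apply, mul_comm]
  refine ContinuousLinearMap.ext fun ξ => Prod.ext ?_ ?_
  · simp [hS.jacobiEnd_fst hz, liouville]
  · have h0 := hy 0
    have h1 := hy 1
    ext i
    simp only [localIsoForm, hN, sub_apply, smul_apply, ContinuousLinearMap.comp_apply, hin,
      ContinuousLinearMap.smulRight_apply, ContinuousLinearMap.coe_fst', tanJ_apply, liouville,
      ContinuousLinearMap.coe_snd', hS.jacobiEnd_snd_apply hz, Prod.snd_sub, Prod.smul_snd,
      PiLp.sub_apply, PiLp.smul_apply, smul_eq_mul, localRicci, Fin.sum_univ_two]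
    fin_cases i
    · simp only [Fin.zero_eta]
      field_simp
      linear_combination z.2 1 * ξ.1 1 * h0 - z.2 1 * ξ.1 0 * h1
    · simp only [Fin.mk_one]
      field_simp
      linear_combination z.2 0 * ξ.1 0 * h1 - z.2 0 * ξ.1 1 * h0

theorem IsLocalSpray.contDiffAt_localIsoForm (hS : IsLocalSpray V S) (hz : z ∈ slit V) :
    ContDiffAt ℝ ∞ (localIsoForm S) z := by
  have h1 : ContDiffAt ℝ ∞ (fun w : Coord 2 => w.2) z := contDiff_snd.contDiffAt
  have h2 : ContDiffAt ℝ ∞ (fun w : Coord 2 => innerSL ℝ w.2) z :=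
    (innerSL ℝ (E := Euc 2)).contDiff.contDiffAt.comp z h1
  have h3 := (h1.norm_sq ℝ).inv (pow_ne_zero 2 (norm_ne_zero_iff.2 hz.2))
  exact h3.smul (((hS.contDiffAt_localRicci hz).smul (h2.clm_comp contDiffAt_const)).sub
    (h2.clm_comp (contDiffAt_const.clm_comp (contDiffAt_jacobiEnd (hS.contDiffAt hz)))))

theorem IsLocalSpray.localIsoForm_vertical (hS : IsLocalSpray V S) (hz : z ∈ slit V) (w : Euc 2) :
    localIsoForm S z (0, w) = 0 := by
  simp [localIsoForm, hS.jacobiEnd_vertical hz]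

variable {M : Type*} [TopologicalSpace M] [ChartedSpace (Euc 2) M]
  [IsManifold (𝓡 2) ∞ M] {e e' : OpenPartialHomeomorph M (Euc 2)}

/-- The Euclidean product in the formula for `α` is not invariant, but `Φ`, `R`, `J` and `ℂ` are,
and `ℂ ≠ 0` allows `α` to be cancelled out of `α ⊗ ℂ`. -/
theorem localIsoForm_transition {S : VField 2 M} (hS : IsSpray S) (he : e ∈ smoothCharts 2 M)
    (he' : e' ∈ smoothCharts 2 M) (hz : z ∈ overlap e e') (hz' : z ∈ slitDomain e) :
    (localIsoForm (locField e' S) (transition e e' z)).comp (fderiv ℝ (transition e e') z) =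
      localIsoForm (locField e S) z := by
  refine ContinuousLinearMap.ext fun ξ => ?_
  have hw := transition_mem_slitDomain he he' hz hz'
  have h := jacobiEnd_transition hS he he' hz hz' ξ
  rw [(hS.isLocalSpray he).jacobiEnd_eq hz', (hS.isLocalSpray he').jacobiEnd_eq hw,
    localRicci_transition hS he he' hz hz'] at h
  simp only [sub_apply, smul_apply, ContinuousLinearMap.smulRight_apply, map_sub, map_smul,
    fderiv_transition_liouville he he' hz, tanJ_comp_fderiv_transition he he' hz, sub_right_inj] at h
  have hne : liouville (transition e e' z) ≠ 0 := fun h0 => hw.2 (congrArg Prod.snd h0)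
  exact smul_left_injective ℝ hne h

/-- The form `α` with `Φ = R J - α ⊗ ℂ` of a spray on a surface. -/
def isoForm (S : VField 2 M) : OneForm 2 M := fun p =>
  (localIsoForm (locField (chartAt (Euc 2) p.1) S) (tcoord (chartAt (Euc 2) p.1) p)).comp
    (mfderiv (𝓡 2).tangent 𝓘(ℝ, Coord 2) (tcoord (chartAt (Euc 2) p.1)) p)

theorem locForm_isoForm {S : VField 2 M} (hS : IsSpray S) (he : e ∈ smoothCharts 2 M)
    (hz : z ∈ slitDomain e) :
    locForm e (isoForm S) z = localIsoForm (locField e S) z := by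
  have hc := chartAt_mem_smoothCharts (n := 2) (tpoint e z : TangentBundle (𝓡 2) M).1
  have ho : z ∈ overlap e (chartAt (Euc 2) (tpoint e z : TangentBundle (𝓡 2) M).1) :=
    mem_overlap hz.1 (mem_chart_source _ _)
  rw [← localIsoForm_transition hS he hc ho hz, fderiv_transition he hc ho]
  rfl

theorem isIsotropicWith_isoForm {S : VField 2 M} (hS : IsSpray S) :
    IsIsotropicWith S (isoForm S) where
  semibasic :=
    { smooth := fun e he z hz =>
        (((hS.isLocalSpray he).contDiffAt_localIsoForm hz).contDiffWithinAt).congr_of_mem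
          (fun w hw => locForm_isoForm hS he hw) hz
      vertical := fun e he z hz w => by
        rw [locForm_isoForm hS he hz, (hS.isLocalSpray he).localIsoForm_vertical hz] }
  jacobi := fun e he z hz => by
    have h : locFun e (ricciScalar S) z = locFun e (ricciCurvature S) z := by
      simp only [locFun, ricciScalar]
      norm_num
    rw [h, locForm_isoForm hS he hz, locFun_ricciCurvature hS he hz]
    exact (hS.isLocalSpray he).jacobiEnd_eq hz

end Surface

/-! ### The operators `d_J` and `d d_J` in terms of second derivatives. -/

section SemibasicForms

variable {n : ℕ} {z : Coord n}

theorem fderiv_dFun_tanJ_apply {f : Coord n → ℝ} (hf : ContDiffAt ℝ ∞ f z) (u η : Coord n) :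
    fderiv ℝ (dFun (fun _ => tanJ n) f) z u η = fderiv ℝ (fderiv ℝ f) z u (tanJ n η) := by
  have h1 : HasFDerivAt (fderiv ℝ f) (fderiv ℝ (fderiv ℝ f) z) z :=
    ((contDiffAt_fderiv_top hf).differentiableAt (by simp)).hasFDerivAt
  have h2 := h1.clm_comp (hasFDerivAt_const (tanJ n) z)
  have h3 : fderiv ℝ (dFun (fun _ => tanJ n) f) z = _ := h2.fderiv
  rw [h3]
  simp

theorem contDiffAt_dFun_tanJ {f : Coord n → ℝ} (hf : ContDiffAt ℝ ∞ f z) :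
    ContDiffAt ℝ ∞ (dFun (fun _ => tanJ n) f) z :=
  (contDiffAt_fderiv_top hf).clm_comp contDiffAt_const

theorem fderiv_fderiv_symm {f : Coord n → ℝ} (hf : ContDiffAt ℝ ∞ f z) (u v : Coord n) :
    fderiv ℝ (fderiv ℝ f) z u v = fderiv ℝ (fderiv ℝ f) z v u :=
  hf.isSymmSndFDerivAt (by simpa using two_le_infty) u v

theorem extD_dFun_tanJ {f : Coord n → ℝ} (hf : ContDiffAt ℝ ∞ f z) (ξ η : Coord n) :
    extD (dFun (fun _ => tanJ n) f) z ξ η =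
      fderiv ℝ (fderiv ℝ f) z ξ (tanJ n η) - fderiv ℝ (fderiv ℝ f) z η (tanJ n ξ) := by
  simp only [extD, sub_apply, ContinuousLinearMap.flip_apply, fderiv_dFun_tanJ_apply hf]

/-- `d_J θ` for a form `θ` that vanishes on vertical vectors. -/
theorem dForm_tanJ_of_semibasic {θ : Coord n → Coord n →L[ℝ] ℝ} (hθ : DifferentiableAt ℝ θ z)
    (hv : ∀ᶠ w in nhds z, ∀ v : Euc n, θ w (0, v) = 0) (ξ η : Coord n) :
    dForm (fun _ => tanJ n) θ z ξ η =
      fderiv ℝ θ z (tanJ n ξ) η - fderiv ℝ θ z (tanJ n η) ξ := by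
  -- Semi-basicity near the point passes to the derivative of `θ`, and it makes `i_J θ` vanish
  -- locally; only two terms of `d_J θ` survive.
  have h1 : ∀ u v, fderiv ℝ θ z u (0, v) = 0 := fun u v => by
    have h2 := hθ.hasFDerivAt.clm_apply (hasFDerivAt_const ((0, v) : Coord n) z)
    have h3 := h2.unique ((hasFDerivAt_const (0 : ℝ) z).congr_of_eventuallyEq (by
      filter_upwards [hv] with w hw using hw v))
    simpa using congrArg (fun L => L u) h3
  have h2 : (fun w => (θ w).comp (tanJ n)) =ᶠ[nhds z] fun _ => 0 := by
    filter_upwards [hv] with w hw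
    refine ContinuousLinearMap.ext fun u => ?_
    simp [hw]
  have h3 : extD (fun w => (θ w).comp (tanJ n)) z = 0 := by
    rw [extD, h2.fderiv_eq, fderiv_fun_const]
    exact ContinuousLinearMap.ext fun u => ContinuousLinearMap.ext fun v => sub_self _
  rw [dForm, h3]
  simp only [extD, sub_apply, ContinuousLinearMap.flip_apply, zero_apply, sub_zero]
  rw [tanJ_apply, tanJ_apply, h1, h1]
  ring

/-- `d_J d_J = 0`. -/
theorem dForm_tanJ_dFun_tanJ {f : Coord n → ℝ} (hf : ContDiffAt ℝ ∞ f z) (c : ℝ)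
    {θ : Coord n → Coord n →L[ℝ] ℝ}
    (hθ : θ =ᶠ[nhds z] fun w => c • dFun (fun _ => tanJ n) f w) (ξ η : Coord n) :
    dForm (fun _ => tanJ n) θ z ξ η = 0 := by
  have hd : HasFDerivAt θ (c • fderiv ℝ (dFun (fun _ => tanJ n) f) z) z :=
    ((((contDiffAt_dFun_tanJ hf).differentiableAt (by simp)).hasFDerivAt).const_smul
      c).congr_of_eventuallyEq hθ
  have hvert : ∀ᶠ w in nhds z, ∀ v : Euc n, θ w (0, v) = 0 := by
    filter_upwards [hθ] with w hw v
    have : ((0, (0 : Euc n)) : Coord n) = 0 := rfl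
    rw [hw]
    simp [dFun, this]
  rw [dForm_tanJ_of_semibasic hd.differentiableAt hvert, hd.fderiv]
  simp only [smul_apply, fderiv_dFun_tanJ_apply hf]
  rw [fderiv_fderiv_symm hf, sub_self]

end SemibasicForms

/-! ### The geodesic equation as `d_h f = 0`, for `f` of degree two. -/

section EulerLagrange

variable {n : ℕ} {V : Set (Euc n)} {S : Coord n → Coord n} {z : Coord n} {f : Coord n → ℝ}

/-- Euler's identity for functions that are positively homogeneous of degree two. -/
theorem fderiv_liouville_of_homogeneous (hf : DifferentiableAt ℝ f z)
    (hom : ∀ c : ℝ, 0 < c → f (scaling n c z) = c ^ 2 * f z) :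
    fderiv ℝ f z (0, z.2) = 2 * f z := by
  have hline : HasDerivAt (fun t : ℝ => scaling n t z) (0, z.2) 1 := by
    have := ((hasDerivAt_id (1 : ℝ)).smul_const z.2)
    simpa using (hasDerivAt_const (1 : ℝ) z.1).prodMk this
  have h1 : scaling n 1 z = z := by simp
  have h2 : HasDerivAt (fun t : ℝ => f (scaling n t z)) (fderiv ℝ f z (0, z.2)) 1 := by
    refine HasFDerivAt.comp_hasDerivAt (1 : ℝ) (f := fun t : ℝ => scaling n t z) ?_ hline
    rw [h1]
    exact hf.hasFDerivAt
  have h3 : HasDerivAt (fun t : ℝ => t ^ 2 * f z) (2 * f z) 1 := by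
    simpa using (hasDerivAt_pow 2 (1 : ℝ)).mul_const (f z)
  refine h2.unique (h3.congr_of_eventuallyEq ?_)
  filter_upwards [Ioi_mem_nhds (zero_lt_one (α := ℝ))] with t ht using hom t ht

/-- The derivative of Euler's identity. -/
theorem fderiv_fderiv_liouville (hV : IsOpen V) (hz : z ∈ slit V)
    (hf : ContDiffAt ℝ ∞ f z) (hE : ∀ w ∈ slit V, fderiv ℝ f w (0, w.2) = 2 * f w)
    (η : Coord n) :
    fderiv ℝ (fderiv ℝ f) z η (0, z.2) = 2 * fderiv ℝ f z η - fderiv ℝ f z (0, η.2) := by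
  have h1 : HasFDerivAt (fderiv ℝ f) (fderiv ℝ (fderiv ℝ f) z) z :=
    ((contDiffAt_fderiv_top hf).differentiableAt (by simp)).hasFDerivAt
  have h2 := h1.clm_apply (hasFDerivAt_liouville z)
  have h3 := (hf.differentiableAt (by simp)).hasFDerivAt.const_mul 2
  have h4 := h2.unique (h3.congr_of_eventuallyEq (by
    filter_upwards [(isOpen_slit hV).mem_nhds hz] with w hw using hE w hw))
  have h5 := congrArg (fun L => L η) h4
  simp only [add_apply, ContinuousLinearMap.comp_apply, ContinuousLinearMap.flip_apply,
    ContinuousLinearMap.prod_apply, zero_apply, ContinuousLinearMap.coe_snd', smul_apply,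
    smul_eq_mul, liouville] at h5
  linarith

/-- In coordinates `2 h η = DS(0, η₁) + (η₁, 0)`, since the `x`-part of `S` is `y`. -/
theorem IsLocalSpray.two_mul_fderiv_horProj (hS : IsLocalSpray V S) (hz : z ∈ slit V)
    (η : Coord n) :
    2 * fderiv ℝ f z (horProj S z η) =
      fderiv ℝ f z (fderiv ℝ S z (0, η.1)) + fderiv ℝ f z (η.1, 0) := by
  rw [← map_add, ← smul_eq_mul, ← map_smul]
  congr 1
  rw [hS.horProj_apply hz]
  refine Prod.ext ?_ ?_
  · simp [hS.fderiv_fst hz, two_smul]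
  · simp [smul_smul]

theorem apply_eq_add_of_split {E : Type*} [NormedAddCommGroup E] [NormedSpace ℝ E] (D : Coord n →L[ℝ] E)
    (η : Coord n) : D η = D (η.1, 0) + D (0, η.2) := by
  rw [← map_add]
  simp

/-- Differentiating `S f = 0` in vertical directions. -/
theorem IsLocalSpray.fderiv_fderiv_spray (hS : IsLocalSpray V S) (hz : z ∈ slit V)
    (hf : ContDiffAt ℝ ∞ f z) (h0 : ∀ w ∈ slit V, fderiv ℝ f w (S w) = 0) (u : Coord n) :
    fderiv ℝ (fderiv ℝ f) z (S z) u = - fderiv ℝ f z (fderiv ℝ S z u) := by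
  have h1 : HasFDerivAt (fderiv ℝ f) (fderiv ℝ (fderiv ℝ f) z) z :=
    ((contDiffAt_fderiv_top hf).differentiableAt (by simp)).hasFDerivAt
  have h2 := h1.clm_apply (hS.differentiableAt hz).hasFDerivAt
  have h3 := h2.unique ((hasFDerivAt_const (0 : ℝ) z).congr_of_eventuallyEq (by
    filter_upwards [hS.mem_nhds hz] with w hw using h0 w hw))
  have h4 := congrArg (fun L => L u) h3
  simp only [add_apply, ContinuousLinearMap.comp_apply, ContinuousLinearMap.flip_apply,
    zero_apply] at h4
  rw [fderiv_fderiv_symm hf]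
  linarith

/-- The geodesic equation `i_S d d_J f = - df` implies `d_h f = 0`. -/
theorem IsLocalSpray.dFun_horProj_eq_zero (hS : IsLocalSpray V S) (hz : z ∈ slit V)
    (hf : ∀ w ∈ slit V, ContDiffAt ℝ ∞ f w)
    (hE : ∀ w ∈ slit V, fderiv ℝ f w (0, w.2) = 2 * f w)
    (hG : ∀ w ∈ slit V, extD (dFun (fun _ => tanJ n) f) w (S w) = - fderiv ℝ f w) :
    dFun (horProj S) f z = 0 := by
  -- The Euler–Lagrange equations: Euler's identity removes the vertical part of the geodesic
  -- equation.
  have hEL : ∀ w ∈ slit V, ∀ η : Coord n,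
      fderiv ℝ (fderiv ℝ f) w (S w) (0, η.1) = fderiv ℝ f w (η.1, 0) := by
    intro w hw η
    have h1 := congrArg (fun L => L η) (hG w hw)
    simp only [extD_dFun_tanJ (hf w hw), neg_apply, tanJ_apply, hS.fst_eq hw,
      fderiv_fderiv_liouville hS.isOpen hw (hf w hw) hE] at h1
    have h2 := apply_eq_add_of_split (fderiv ℝ f w) η
    linarith
  -- Conservation of energy, `S f = 0`: the Euler–Lagrange equations at `η = S` read `2 S f = S f`.
  have h0 : ∀ w ∈ slit V, fderiv ℝ f w (S w) = 0 := by
    intro w hw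
    have h1 := hEL w hw (S w)
    rw [hS.fst_eq hw, fderiv_fderiv_liouville hS.isOpen hw (hf w hw) hE] at h1
    have h2 := apply_eq_add_of_split (fderiv ℝ f w) (S w)
    rw [hS.fst_eq hw] at h2
    linarith
  refine ContinuousLinearMap.ext fun η => ?_
  have h1 := hS.two_mul_fderiv_horProj (f := f) hz η
  have h2 := hS.fderiv_fderiv_spray hz (hf z hz) h0 (0, η.1)
  rw [hEL z hz] at h2
  simp only [dFun, ContinuousLinearMap.comp_apply, zero_apply]
  linarith

/-- `d_h f = 0` implies the geodesic equation `i_S d d_J f = - df`. -/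
theorem IsLocalSpray.extD_dFun_tanJ_spray (hS : IsLocalSpray V S) (hz : z ∈ slit V)
    (hf : ∀ w ∈ slit V, ContDiffAt ℝ ∞ f w)
    (hE : ∀ w ∈ slit V, fderiv ℝ f w (0, w.2) = 2 * f w)
    (hH : ∀ w ∈ slit V, dFun (horProj S) f w = 0) :
    extD (dFun (fun _ => tanJ n) f) z (S z) = - fderiv ℝ f z := by
  -- `S` is horizontal, so `d_h f = 0` contains `S f = 0`.
  have h0 : ∀ w ∈ slit V, fderiv ℝ f w (S w) = 0 := by
    intro w hw
    have h1 := congrArg (fun L => L (S w)) (hH w hw)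
    simpa [dFun, hS.horProj_spray hw] using h1
  refine ContinuousLinearMap.ext fun η => ?_
  have h1 := hS.two_mul_fderiv_horProj (f := f) hz η
  have h2 := hS.fderiv_fderiv_spray hz (hf z hz) h0 (0, η.1)
  have h3 : fderiv ℝ f z (horProj S z η) = 0 := congrArg (fun L => L η) (hH z hz)
  have h4 := apply_eq_add_of_split (fderiv ℝ f z) η
  simp only [extD_dFun_tanJ (hf z hz), neg_apply, tanJ_apply, hS.fst_eq hz,
      fderiv_fderiv_liouville hS.isOpen hz (hf z hz) hE]
  linarith

end EulerLagrange

/-! ### The identity `d_J R = 2 α`. -/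

section Surface

variable {V : Set (Euc 2)} {S : Coord 2 → Coord 2} {z : Coord 2}

theorem liouville_ne_zero {n : ℕ} {V : Set (Euc n)} {z : Coord n} (hz : z ∈ slit V) :
    liouville z ≠ 0 :=
  fun h => hz.2 (congrArg Prod.snd h)

/-- Evaluate `Φ = R J - α ⊗ ℂ` at `S`, where `Φ(S) = 0` and `J S = ℂ`. -/
theorem IsLocalSpray.localIsoForm_apply_spray (hS : IsLocalSpray V S) (hz : z ∈ slit V) :
    localIsoForm S z (S z) = localRicci S z := by
  have h := hS.jacobiEnd_spray hz
  rw [hS.jacobiEnd_eq hz] at h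
  simp only [sub_apply, smul_apply, ContinuousLinearMap.smulRight_apply,
    hS.tangent_apply z hz, sub_eq_zero] at h
  exact (smul_left_injective ℝ (liouville_ne_zero hz) h).symm

theorem IsLocalSpray.localIsoForm_congr (hS : IsLocalSpray V S) (hz : z ∈ slit V) {ξ η : Coord 2}
    (h : ξ.1 = η.1) : localIsoForm S z ξ = localIsoForm S z η := by
  have : ξ - η = (0, ξ.2 - η.2) := Prod.ext (sub_eq_zero.2 h) rfl
  rw [← sub_eq_zero, ← map_sub, this, hS.localIsoForm_vertical hz]

/-- `R` and `Φ` have degree two, the inner product with `y` degree one, and `‖y‖⁻²` degree minus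
two. -/
theorem IsLocalSpray.localIsoForm_scaling (hS : IsLocalSpray V S) (hz : z ∈ slit V) {c : ℝ}
    (hc : 0 < c) (ξ : Coord 2) :
    localIsoForm S (scaling 2 c z) ξ = c * localIsoForm S z ξ := by
  simp only [localIsoForm, smul_apply, sub_apply, ContinuousLinearMap.comp_apply,
    ContinuousLinearMap.coe_snd', hS.jacobiEnd_scaling_snd hz hc, hS.localRicci_scaling hz hc]
  simp only [scaling_apply, norm_smul, smul_apply, map_smul, smul_eq_mul, Real.norm_eq_abs, mul_pow, sq_abs,
    ContinuousLinearMap.coe_fst']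
  field_simp

/-- If `d_J α = 0` then `d_J R = 2 α`. -/
theorem IsLocalSpray.fderiv_localRicci_tanJ (hS : IsLocalSpray V S) (hz : z ∈ slit V)
    (hα : ∀ ξ η, dForm (fun _ => tanJ 2) (localIsoForm S) z ξ η = 0) (ξ : Coord 2) :
    fderiv ℝ (localRicci S) z (tanJ 2 ξ) = 2 * localIsoForm S z ξ := by
  have hd : DifferentiableAt ℝ (localIsoForm S) z :=
    (hS.contDiffAt_localIsoForm hz).differentiableAt (by simp)
  have h1 := hd.hasFDerivAt.clm_apply (hS.differentiableAt hz).hasFDerivAt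
  have h2 := h1.unique
    (((hS.contDiffAt_localRicci hz).differentiableAt
      (by simp)).hasFDerivAt.congr_of_eventuallyEq (by
      filter_upwards [hS.mem_nhds hz] with w hw using hS.localIsoForm_apply_spray hw))
  have h3 := congrArg (fun L => L (tanJ 2 ξ)) h2
  simp only [add_apply, ContinuousLinearMap.comp_apply, ContinuousLinearMap.flip_apply] at h3
  -- `d_J α (ξ, S) = 0` exchanges the derivative of `α` along `J ξ`, evaluated at `S`, for its
  -- derivative along `J S = ℂ`, evaluated at `ξ`. By homogeneity (`h5`) the latter is `α(ξ)`.
  have h4 := hα ξ (S z)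
  rw [dForm_tanJ_of_semibasic hd (by
    filter_upwards [hS.mem_nhds hz] with w hw using hS.localIsoForm_vertical hw)] at h4
  have h5 : fderiv ℝ (localIsoForm S) z (tanJ 2 (S z)) ξ = localIsoForm S z ξ := by
    have hline : HasDerivAt (fun t : ℝ => scaling 2 t z) (0, z.2) 1 := by
      have := ((hasDerivAt_id (1 : ℝ)).smul_const z.2)
      simpa using (hasDerivAt_const (1 : ℝ) z.1).prodMk this
    have k0 : scaling 2 1 z = z := by simp
    have k1 : HasDerivAt (fun t : ℝ => localIsoForm S (scaling 2 t z) ξ)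
        (fderiv ℝ (localIsoForm S) z (0, z.2) ξ) 1 := by
      have := HasFDerivAt.comp_hasDerivAt (1 : ℝ) (f := fun t : ℝ => scaling 2 t z)
        (l := localIsoForm S) (l' := fderiv ℝ (localIsoForm S) z)
        (by rw [k0]; exact hd.hasFDerivAt) hline
      simpa using this.clm_apply (hasDerivAt_const (1 : ℝ) ξ)
    have k2 : HasDerivAt (fun t : ℝ => t * localIsoForm S z ξ) (localIsoForm S z ξ) 1 := by
      simpa using (hasDerivAt_id (1 : ℝ)).mul_const (localIsoForm S z ξ)
    rw [hS.tangent_apply z hz]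
    refine k1.unique (k2.congr_of_eventuallyEq ?_)
    filter_upwards [Ioi_mem_nhds (zero_lt_one (α := ℝ))] with t ht
      using hS.localIsoForm_scaling hz ht ξ
  -- The second copy of `α(ξ)`: the `x`-part of `DS(J ξ)` is that of `ξ`.
  have h6 : localIsoForm S z (fderiv ℝ S z (tanJ 2 ξ)) = localIsoForm S z ξ :=
    hS.localIsoForm_congr hz (hS.fderiv_fst hz _)
  rw [← h3, h6]
  linarith

end Surface

/-! ### Continuity at the zero section. -/

section Continuity

variable {n : ℕ}

/-- A positively homogeneous function that is continuous off the zero section is continuous at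
the zero section. -/
theorem continuousAt_zero_of_homogeneous {V : Set (Euc n)} (hV : IsOpen V) {f : Coord n → ℝ}
    (hf : ContinuousOn f (slit V))
    (hom : ∀ x ∈ V, ∀ (y : Euc n) (c : ℝ), 0 ≤ c → f (x, c • y) = c * f (x, y)) {x : Euc n}
    (hx : x ∈ V) : ContinuousAt f (x, 0) := by
  obtain ⟨r, hr, hrV⟩ := Metric.nhds_basis_closedBall.mem_iff.1 (hV.mem_nhds hx)
  -- A bound `C` on this compact set extends by homogeneity to `|f(a, b)| ≤ C ‖b‖` over the ball.
  have hK : IsCompact (Metric.closedBall x r ×ˢ Metric.sphere (0 : Euc n) 1) :=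
    (isCompact_closedBall x r).prod (isCompact_sphere 0 1)
  obtain ⟨C, hC⟩ := hK.exists_bound_of_continuousOn (hf.mono (by
    rintro ⟨a, b⟩ ⟨ha, hb⟩
    exact ⟨hrV ha, Metric.ne_of_mem_sphere hb one_ne_zero⟩))
  have h0 : ∀ a ∈ V, f (a, 0) = 0 := fun a ha => by
    simpa using hom a ha 0 0 le_rfl
  have hb : ∀ w : Coord n, w.1 ∈ Metric.closedBall x r → ‖f w‖ ≤ C * ‖w.2‖ := by
    rintro ⟨a, b⟩ ha
    by_cases hb0 : b = 0
    · subst hb0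
      simp [h0 a (hrV ha)]
    · have hn : ‖b‖ ≠ 0 := norm_ne_zero_iff.2 hb0
      have h1 := hom a (hrV ha) (‖b‖⁻¹ • b) ‖b‖ (norm_nonneg b)
      rw [smul_smul, mul_inv_cancel₀ hn, one_smul] at h1
      rw [h1, norm_mul, norm_norm, mul_comm]
      refine mul_le_mul_of_nonneg_right (hC (a, ‖b‖⁻¹ • b) ⟨ha, ?_⟩) (norm_nonneg b)
      simp [norm_smul, hn]
  rw [ContinuousAt, h0 x hx]
  refine squeeze_zero_norm' (a := fun w : Coord n => C * ‖w.2‖) ?_ ?_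
  · have : ∀ᶠ w : Coord n in nhds (x, 0), w.1 ∈ Metric.closedBall x r :=
      continuousAt_fst.eventually (Metric.closedBall_mem_nhds x hr)
    filter_upwards [this] with w hw using hb w hw
  · have : Continuous fun w : Coord n => C * ‖w.2‖ := by fun_prop
    simpa using this.tendsto (x, (0 : Euc n))

end Continuity

/-! ### Regularity of the metric tensor. -/

section Metric

variable {n : ℕ} {V : Set (Euc n)} {z : Coord n}

theorem metricTensor_apply (hz : z ∈ slit V) {F : Coord n → ℝ}
    (hF : ∀ w ∈ slit V, ContDiffAt ℝ ∞ (fun w => F w ^ 2) w) (i j : Fin n) :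
    metricTensor F z i j = (1 / 2 : ℝ) * fderiv ℝ (fderiv ℝ fun w => F w ^ 2) z
      (0, EuclideanSpace.single i 1) (0, EuclideanSpace.single j 1) := by
  have h1 : (fun y => fderiv ℝ (fun y' => F (z.1, y') ^ 2) y (EuclideanSpace.single j 1))
      =ᶠ[nhds z.2] fun y => fderiv ℝ (fun w => F w ^ 2) (z.1, y)
        (0, EuclideanSpace.single j 1) := by
    filter_upwards [isOpen_ne.mem_nhds hz.2] with y hy
    have h2 := HasFDerivAt.comp (g := fun w => F w ^ 2) (f := fun y : Euc n => (z.1, y)) y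
      ((hF (z.1, y) ⟨hz.1, hy⟩).differentiableAt (by simp)).hasFDerivAt
      (hasFDerivAt_prodMk_right z.1 y)
    have h3 : fderiv ℝ (fun y' => F (z.1, y') ^ 2) y = _ := h2.fderiv
    rw [h3]
    simp
  have h4 : HasFDerivAt (fderiv ℝ fun w => F w ^ 2) _ z :=
    ((contDiffAt_fderiv_top (hF z hz)).differentiableAt (by simp)).hasFDerivAt
  have h5 := (HasFDerivAt.comp (g := fderiv ℝ fun w => F w ^ 2) (f := fun y : Euc n => (z.1, y))
    z.2 h4 (hasFDerivAt_prodMk_right z.1 z.2)).clm_apply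
    (hasFDerivAt_const ((0, EuclideanSpace.single j 1) : Coord n) z.2)
  have h6 : fderiv ℝ (fun y => fderiv ℝ (fun w => F w ^ 2) (z.1, y)
        (0, EuclideanSpace.single j 1)) z.2 = _ := h5.fderiv
  rw [metricTensor, Matrix.of_apply, h1.fderiv_eq, h6]
  simp

/-- If `d d_J F²` is nondegenerate, so is the metric tensor. -/
theorem rank_metricTensor (hz : z ∈ slit V) {F : Coord n → ℝ}
    (hF : ∀ w ∈ slit V, ContDiffAt ℝ ∞ (fun w => F w ^ 2) w)
    (hr : formRank (extD (dFun (fun _ => tanJ n) fun w => F w ^ 2) z) = 2 * n) :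
    (metricTensor F z).rank = n := by
  set H := fderiv ℝ (fderiv ℝ fun w => F w ^ 2) z with hH
  have hker : LinearMap.ker (extD (dFun (fun _ => tanJ n) fun w => F w ^ 2) z :
      Coord n →ₗ[ℝ] (Coord n →L[ℝ] ℝ)) = ⊥ := by
    have h1 := LinearMap.finrank_range_add_finrank_ker
      (extD (dFun (fun _ => tanJ n) fun w => F w ^ 2) z : Coord n →ₗ[ℝ] (Coord n →L[ℝ] ℝ))
    have h2 : Module.finrank ℝ (Coord n) = 2 * n := by
      rw [Module.finrank_prod, finrank_euclideanSpace_fin, two_mul]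
    rw [formRank] at hr
    exact Submodule.finrank_eq_zero.1 (by omega)
  have hinj : Function.Injective (metricTensor F z).mulVec := by
    refine (injective_iff_map_eq_zero (metricTensor F z).mulVecLin).2 ?_
    intro w hw
    have hHw : ∀ v : Euc n, H (0, v) (0, WithLp.toLp 2 w) = 0 := by
      intro v
      have hbasis : ∀ u : Euc n, u = ∑ i, u i • EuclideanSpace.single i (1 : ℝ) := fun u => by
        simpa using ((EuclideanSpace.basisFun (Fin n) ℝ).sum_repr u).symm
      have hi : ∀ i, H (0, EuclideanSpace.single i 1) (0, WithLp.toLp 2 w) = 0 := by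
        intro i
        have h1 := congrFun hw i
        simp only [Matrix.mulVecLin_apply, Matrix.mulVec, dotProduct,
          metricTensor_apply hz hF, Pi.zero_apply] at h1
        have h2 : (0, WithLp.toLp 2 w) = ∑ j, w j • ((0, EuclideanSpace.single j 1) : Coord n) := by
          refine Prod.ext ?_ ?_
          · simp [Prod.fst_sum]
          · simpa [Prod.snd_sum] using hbasis (WithLp.toLp 2 w)
        rw [h2, map_sum]
        have h3 : (1 / 2 : ℝ) * ∑ j, H (0, EuclideanSpace.single i 1)
            (w j • (0, EuclideanSpace.single j 1)) = 0 := by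
          rw [← h1, Finset.mul_sum]
          refine Finset.sum_congr rfl fun j _ => ?_
          rw [map_smul, smul_eq_mul]
          ring
        linarith
      have h2 : ((0, v) : Coord n) = ∑ j, v j • ((0, EuclideanSpace.single j 1) : Coord n) := by
        refine Prod.ext ?_ ?_
        · simp [Prod.fst_sum]
        · simpa [Prod.snd_sum] using hbasis v
      rw [h2, map_sum, sum_apply]
      refine Finset.sum_eq_zero fun j _ => ?_
      rw [map_smul, smul_apply, hi, smul_zero]
    -- A null vector `w` of the metric tensor gives a vertical vector `(0, w)` in the kernel of `d
    -- d_J F²`: against `η` the form only sees the vertical Hessian at `(w, η₁)`.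
    have hmem : ((0, WithLp.toLp 2 w) : Coord n) ∈ LinearMap.ker
        (extD (dFun (fun _ => tanJ n) fun w => F w ^ 2) z : Coord n →ₗ[ℝ] (Coord n →L[ℝ] ℝ)) := by
      refine LinearMap.mem_ker.2 (ContinuousLinearMap.ext fun η => ?_)
      have h00 : ((0, (0 : Euc n)) : Coord n) = 0 := rfl
      have := extD_dFun_tanJ (hF z hz) (0, WithLp.toLp 2 w) η
      rw [fderiv_fderiv_symm (hF z hz)] at this
      simpa [← hH, hHw, h00] using this
    rw [hker, Submodule.mem_bot] at hmem
    have := congrArg (fun u : Coord n => u.2.ofLp) hmem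
    simpa using this
  have := Matrix.rank_of_isUnit _ (Matrix.mulVec_injective_iff_isUnit.1 hinj)
  simpa using this

end Metric

/-! ### Functions on the tangent bundle and their coordinate expressions. -/

section Functions

variable {n : ℕ} {M : Type*} [TopologicalSpace M] [ChartedSpace (Euc n) M]
  [IsManifold (𝓡 n) ∞ M] {e : OpenPartialHomeomorph M (Euc n)} {f : TangentBundle (𝓡 n) M → ℝ}

theorem locFun_tcoord_eventuallyEq (he : e ∈ smoothCharts n M) {p : TangentBundle (𝓡 n) M}
    (hp : p.1 ∈ e.source) : f =ᶠ[nhds p] locFun e f ∘ tcoord e := by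
  filter_upwards [(isOpen_bundle_source e).mem_nhds hp] with q hq
  simp only [Function.comp, locFun]
  rw [tpoint_tcoord he hq]

theorem contMDiffOn_slitTangent
    (h : ∀ e ∈ smoothCharts n M, ContDiffOn ℝ ∞ (locFun e f) (slitDomain e)) :
    ContMDiffOn (𝓡 n).tangent 𝓘(ℝ, ℝ) ∞ f (slitTangent n M) := by
  intro p hp
  have hc := chartAt_mem_smoothCharts (n := n) p.1
  have hps : p.1 ∈ (chartAt (Euc n) p.1).source := mem_chart_source _ _
  have h1 : ContDiffAt ℝ ∞ (locFun (chartAt (Euc n) p.1) f) (tcoord (chartAt (Euc n) p.1) p) :=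
    (h _ hc).contDiffAt ((isOpen_slitDomain _).mem_nhds (tcoord_mem_slitDomain hc hps hp))
  have h2 := h1.contMDiffAt.comp p
    ((contMDiffOn_tcoord hc).contMDiffAt ((isOpen_bundle_source _).mem_nhds hps))
  exact (h2.congr_of_eventuallyEq (locFun_tcoord_eventuallyEq hc hps)).contMDiffWithinAt

theorem contDiffOn_locFun (he : e ∈ smoothCharts n M)
    (hf : ContMDiffOn (𝓡 n).tangent 𝓘(ℝ, ℝ) ∞ f (slitTangent n M)) :
    ContDiffOn ℝ ∞ (locFun e f) (slitDomain e) := by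
  rw [← contMDiffOn_iff_contDiffOn]
  have h0 : ContMDiffOn 𝓘(ℝ, Coord n) (𝓡 n).tangent ∞
      (tpoint e : Coord n → TangentBundle (𝓡 n) M) (slitDomain e) :=
    (contMDiffOn_tpoint he).mono fun _ h => h.1
  exact hf.comp h0 fun _ h => tpoint_mem_slitTangent he h

theorem continuousAt_of_locFun (he : e ∈ smoothCharts n M) {p : TangentBundle (𝓡 n) M}
    (hp : p.1 ∈ e.source) (h : ContinuousAt (locFun e f) (tcoord e p)) : ContinuousAt f p := by
  have h1 := h.comp ((contMDiffOn_tcoord he).contMDiffAt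
    ((isOpen_bundle_source e).mem_nhds hp)).continuousAt
  exact h1.congr (locFun_tcoord_eventuallyEq he hp).symm

end Functions

/-! ### Constancy of the sign of a nowhere vanishing function. -/

section Sign

variable {n : ℕ} {M : Type*} [TopologicalSpace M] [ChartedSpace (Euc n) M]
  [IsManifold (𝓡 n) ∞ M]

/-- A continuous function without zeros on `T₀M` has constant sign on each fibre. -/
theorem fibre_sign {f : TangentBundle (𝓡 n) M → ℝ} (hn : 1 < n)
    (hf : ∀ e ∈ smoothCharts n M, ContinuousOn (locFun e f) (slitDomain e))
    (h0 : ∀ p ∈ slitTangent n M, f p ≠ 0) {x : M} {v w : TangentSpace (𝓡 n) x} (hv : v ≠ 0)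
    (hw : w ≠ 0) (hfv : 0 < f ⟨x, v⟩) : 0 < f ⟨x, w⟩ := by
  set e := chartAt (Euc n) x
  have he : e ∈ smoothCharts n M := chartAt_mem_smoothCharts x
  have hx : x ∈ e.source := mem_chart_source _ _
  -- A punctured fibre is connected because `1 < n`; a sign change would force a zero on it.
  have hconn : IsPreconnected ({0}ᶜ : Set (Euc n)) :=
    (isConnected_compl_singleton_of_one_lt_rank (by
      rw [← Module.finrank_eq_rank, finrank_euclideanSpace_fin]
      exact_mod_cast hn) 0).isPreconnected
  have hg : ContinuousOn (fun y : Euc n => locFun e f (e x, y)) {0}ᶜ :=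
    (hf e he).comp (by fun_prop) fun y hy => ⟨e.map_source hx, hy⟩
  have hval : ∀ u : TangentSpace (𝓡 n) x, locFun e f (e x, (tcoord e ⟨x, u⟩).2) = f ⟨x, u⟩ :=
    fun u => congrArg f (tpoint_tcoord he (p := ⟨x, u⟩) hx)
  have hmem : ∀ u : TangentSpace (𝓡 n) x, u ≠ 0 → (tcoord e ⟨x, u⟩).2 ∈ ({0}ᶜ : Set (Euc n)) :=
    fun u hu h => hu ((tcoord_snd_eq_zero_iff he (p := ⟨x, u⟩) hx).1 h)
  by_contra hneg
  obtain ⟨y, hy, hy0⟩ := hconn.intermediate_value (hmem w hw) (hmem v hv) hg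
    (show (0 : ℝ) ∈ Set.Icc _ _ from ⟨by rw [hval]; exact not_lt.1 hneg, by rw [hval]; exact hfv.le⟩)
  exact h0 _ (tpoint_mem_slitTangent he (z := (e x, y)) ⟨e.map_source hx, hy⟩) hy0

theorem isOpen_exists_fibre_pos {f : TangentBundle (𝓡 n) M → ℝ}
    (hf : ∀ e ∈ smoothCharts n M, ContinuousOn (locFun e f) (slitDomain e)) :
    IsOpen {x : M | ∃ v : TangentSpace (𝓡 n) x, v ≠ 0 ∧ 0 < f ⟨x, v⟩} := by
  rw [isOpen_iff_mem_nhds]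
  rintro x ⟨v, hv, hfv⟩
  set e := chartAt (Euc n) x
  have he : e ∈ smoothCharts n M := chartAt_mem_smoothCharts x
  have hx : x ∈ e.source := mem_chart_source _ _
  set y : Euc n := (tcoord e ⟨x, v⟩).2 with hy
  have hy0 : y ≠ 0 := fun h => hv ((tcoord_snd_eq_zero_iff he (p := ⟨x, v⟩) hx).1 h)
  have hval : locFun e f (e x, y) = f ⟨x, v⟩ :=
    congrArg f (tpoint_tcoord he (p := ⟨x, v⟩) hx)
  -- The fibre coordinate `y` stays fixed while the base point moves.
  have hc : ContinuousAt (fun x' => locFun e f (e x', y)) x := by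
    have h1 : ContinuousAt (locFun e f) (e x, y) :=
      (hf e he).continuousAt ((isOpen_slitDomain e).mem_nhds ⟨e.map_source hx, hy0⟩)
    exact ContinuousAt.comp (g := locFun e f) (f := fun x' => (e x', y)) h1
      ((e.continuousAt hx).prodMk continuousAt_const)
  filter_upwards [e.open_source.mem_nhds hx, hc.eventually (lt_mem_nhds (hval ▸ hfv))] with x' hx' h
  have hz : ((e x', y) : Coord n) ∈ slitDomain e := ⟨e.map_source hx', hy0⟩
  have hp := tpoint_mem_slitTangent he hz
  have hpe : (tpoint e (e x', y) : TangentBundle (𝓡 n) M).1 = x' := e.left_inv hx'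
  have hgoal : ∀ p : TangentBundle (𝓡 n) M, p.1 = x' → p.2 ≠ 0 → 0 < f p →
      ∃ v : TangentSpace (𝓡 n) x', v ≠ 0 ∧ 0 < f ⟨x', v⟩ := by
    rintro ⟨a, b⟩ rfl h1 h2
    exact ⟨b, h1, h2⟩
  exact hgoal _ hpe hp h

/-- The base points with positive values form an open set, whose complement is the corresponding
open set for `-f`; connectedness of `M` leaves one of the two. -/
theorem exists_sign [ConnectedSpace M] {f : TangentBundle (𝓡 n) M → ℝ} (hn : 1 < n)
    (hf : ∀ e ∈ smoothCharts n M, ContinuousOn (locFun e f) (slitDomain e))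
    (h0 : ∀ p ∈ slitTangent n M, f p ≠ 0) :
    ∃ ε : ℝ, ε * ε = 1 ∧ ∀ p ∈ slitTangent n M, 0 < ε * f p := by
  have hf' : ∀ e ∈ smoothCharts n M, ContinuousOn (locFun e fun p => - f p) (slitDomain e) :=
    fun e he => (hf e he).neg
  have hP := isOpen_exists_fibre_pos hf
  have hN := isOpen_exists_fibre_pos hf'
  set P := {x : M | ∃ v : TangentSpace (𝓡 n) x, v ≠ 0 ∧ 0 < f ⟨x, v⟩} with hPdef
  have hcompl : Pᶜ = {x : M | ∃ v : TangentSpace (𝓡 n) x, v ≠ 0 ∧ 0 < - f ⟨x, v⟩} := by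
    ext x
    constructor
    · intro hx
      have : Nonempty (Fin n) := ⟨⟨0, by omega⟩⟩
      obtain ⟨v, hv⟩ := exists_ne (0 : Euc n)
      refine ⟨v, hv, ?_⟩
      have h1 : ¬ 0 < f ⟨x, v⟩ := fun h => hx ⟨v, hv, h⟩
      have h2 : f ⟨x, v⟩ ≠ 0 := h0 ⟨x, v⟩ hv
      exact neg_pos.2 (lt_of_le_of_ne (not_lt.1 h1) h2)
    · rintro ⟨v, hv, hneg⟩ ⟨w, hw, hpos⟩
      have := fibre_sign hn hf h0 hw hv hpos
      linarith
  have hclopen : IsClopen P := ⟨⟨by rw [hcompl]; exact hN⟩, hP⟩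
  rcases isClopen_iff.1 hclopen with h | h
  · refine ⟨-1, by norm_num, ?_⟩
    rintro ⟨x, w⟩ hw
    have hx : x ∉ P := by simp [h]
    have h1 : ¬ 0 < f ⟨x, w⟩ := fun hpos => hx ⟨w, hw, hpos⟩
    have := lt_of_le_of_ne (not_lt.1 h1) (h0 _ hw)
    linarith
  · refine ⟨1, by norm_num, ?_⟩
    rintro ⟨x, w⟩ hw
    have hx : x ∈ P := by simp [h]
    obtain ⟨v, hv, hpos⟩ := hx
    have := fibre_sign hn hf h0 hv hw hpos
    linarith

end Sign

/-! ### Uniqueness and components of `α`; necessity of the two conditions. -/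

section Surface

variable {M : Type*} [TopologicalSpace M] [ChartedSpace (Euc 2) M]
  [IsManifold (𝓡 2) ∞ M] {e : OpenPartialHomeomorph M (Euc 2)} {S : VField 2 M}
  {α : OneForm 2 M} {z : Coord 2}

theorem ricciScalar_eq (S : VField 2 M) : ricciScalar S = ricciCurvature S := by
  funext p
  simp only [ricciScalar]
  norm_num

/-- `α ⊗ ℂ = R J - Φ` determines `α` where `ℂ ≠ 0`. -/
theorem IsIsotropicWith.locForm_eq (hα : IsIsotropicWith S α) (hS : IsSpray S)
    (he : e ∈ smoothCharts 2 M) (hz : z ∈ slitDomain e) :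
    locForm e α z = localIsoForm (locField e S) z := by
  have h := hα.jacobi e he z hz
  rw [ricciScalar_eq, locFun_ricciCurvature hS he hz, (hS.isLocalSpray he).jacobiEnd_eq hz,
    sub_right_inj] at h
  refine ContinuousLinearMap.ext fun ξ => ?_
  exact (smul_left_injective ℝ (liouville_ne_zero (V := e.target) hz)
    (congrArg (fun L => L ξ) h)).symm

/-- These are the entries of `R^i_j = R δ^i_j - α_j y^i`, with `R = R^1_1 + R^2_2` substituted on
the diagonal. -/
theorem IsIsotropicWith.components (hα : IsIsotropicWith S α) (hS : IsSpray S)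
    (he : e ∈ smoothCharts 2 M) (hz : z ∈ slitDomain e) :
    (z.2 0 ≠ 0 →
      locForm e α z (dx 0) = jacobiComp (locField e S) z 1 1 / z.2 0 ∧
      locForm e α z (dx 1) = - jacobiComp (locField e S) z 0 1 / z.2 0) ∧
    (z.2 1 ≠ 0 →
      locForm e α z (dx 0) = - jacobiComp (locField e S) z 1 0 / z.2 1 ∧
      locForm e α z (dx 1) = jacobiComp (locField e S) z 0 0 / z.2 1) := by
  have h : ∀ i j, jacobiComp (locField e S) z i j =
      localRicci (locField e S) z * (dx j : Coord 2).1 i - locForm e α z (dx j) * z.2 i := by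
    intro i j
    have h1 := congrArg (fun L => (L (dx j)).2 i) (hα.jacobi e he z hz)
    rw [ricciScalar_eq, locFun_ricciCurvature hS he hz] at h1
    simpa [liouville, jacobiComp] using h1
  have h00 := h 0 0
  have h01 := h 0 1
  have h10 := h 1 0
  have h11 := h 1 1
  have hρ : localRicci (locField e S) z =
      jacobiComp (locField e S) z 0 0 + jacobiComp (locField e S) z 1 1 := by
    simp [localRicci, Fin.sum_univ_two]
  simp only [dx, PiLp.single_apply] at h00 h01 h10 h11 ⊢
  norm_num at h00 h01 h10 h11
  refine ⟨fun hy => ⟨?_, ?_⟩, fun hy => ⟨?_, ?_⟩⟩ <;> rw [eq_div_iff hy] <;> linarith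

theorem dJClosed_iff (hα : IsIsotropicWith S α) (hS : IsSpray S) :
    DJClosed α ↔ ∀ e ∈ smoothCharts 2 M, ∀ z ∈ slitDomain e, ∀ ξ η : Coord 2,
      dForm (fun _ => tanJ 2) (localIsoForm (locField e S)) z ξ η = 0 := by
  have hcongr : ∀ e ∈ smoothCharts 2 M, ∀ z ∈ slitDomain e, ∀ ξ η : Coord 2,
      dForm (fun _ => tanJ 2) (locForm e α) z ξ η =
        dForm (fun _ => tanJ 2) (localIsoForm (locField e S)) z ξ η := by
    intro e he z hz ξ η
    have h1 : locForm e α =ᶠ[nhds z] localIsoForm (locField e S) := by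
      filter_upwards [(isOpen_slitDomain e).mem_nhds hz] with w hw using hα.locForm_eq hS he hw
    have h2 : (fun w => (locForm e α w).comp (tanJ 2)) =ᶠ[nhds z]
        fun w => (localIsoForm (locField e S) w).comp (tanJ 2) := by
      filter_upwards [h1] with w hw
      rw [hw]
    simp only [dForm, extD, h1.fderiv_eq, h2.fderiv_eq]
  constructor
  · intro h e he z hz ξ η
    rw [← hcongr e he z hz, h e he z hz]
  · intro h e he z hz ξ η
    rw [hcongr e he z hz, h e he z hz]

theorem locFun_ricciScalar_eventuallyEq (hS : IsSpray S) (he : e ∈ smoothCharts 2 M)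
    (hz : z ∈ slitDomain e) :
    locFun e (ricciScalar S) =ᶠ[nhds z] localRicci (locField e S) := by
  filter_upwards [(isOpen_slitDomain e).mem_nhds hz] with w hw
  rw [ricciScalar_eq, locFun_ricciCurvature hS he hw]

theorem dFun_congr {n : ℕ} {f g : Coord n → ℝ} {z : Coord n} (h : f =ᶠ[nhds z] g)
    (K : Coord n → Coord n →L[ℝ] Coord n) : dFun K f z = dFun K g z := by
  rw [dFun, dFun, h.fderiv_eq]

/-- Rewrites `F d_J F` through `F²`, the quantity in Euler's identity and the geodesic equation. -/
theorem smul_dFun_eq_half_dFun_sq {n : ℕ} {f : Coord n → ℝ} {z : Coord n}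
    (hf : DifferentiableAt ℝ f z) (K : Coord n → Coord n →L[ℝ] Coord n) :
    f z • dFun K f z = (1 / 2 : ℝ) • dFun K (fun w => f w ^ 2) z := by
  have h := (hf.hasFDerivAt.pow 2).fderiv
  refine ContinuousLinearMap.ext fun ξ => ?_
  simp only [dFun]
  rw [h]
  simp
  ring

theorem IsFinsler.contDiffAt_locFun {F : TangentBundle (𝓡 2) M → ℝ} (hF : IsFinsler F)
    (he : e ∈ smoothCharts 2 M) (hz : z ∈ slitDomain e) : ContDiffAt ℝ ∞ (locFun e F) z :=
  (contDiffOn_locFun he hF.smooth).contDiffAt ((isOpen_slitDomain e).mem_nhds hz)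

theorem IsFinsler.fderiv_sq_liouville {F : TangentBundle (𝓡 2) M → ℝ} (hF : IsFinsler F)
    (he : e ∈ smoothCharts 2 M) (hz : z ∈ slitDomain e) :
    fderiv ℝ (fun w => locFun e F w ^ 2) z (0, z.2) = 2 * locFun e F z ^ 2 := by
  refine fderiv_liouville_of_homogeneous
    (((hF.contDiffAt_locFun he hz).pow 2).differentiableAt (by simp)) fun c hc => ?_
  have h : locFun e F (scaling 2 c z) = c * locFun e F z := by
    simp only [locFun, scaling_apply]
    rw [tpoint_smul]
    exact hF.homogeneous _ _ c hc.le
  rw [h]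
  ring

/-- The Ricci curvature of a surface of constant curvature `κ` is `κ F²`. -/
theorem HasConstantCurvature.localRicci_eq {F : TangentBundle (𝓡 2) M → ℝ} {κ : ℝ}
    (h : HasConstantCurvature F S κ) (hF : IsFinsler F) (he : e ∈ smoothCharts 2 M)
    (hz : z ∈ slitDomain e) : localRicci (locField e S) z = κ * locFun e F z ^ 2 := by
  have hE := hF.fderiv_sq_liouville he hz
  have h1 := h e he z hz
  rw [smul_dFun_eq_half_dFun_sq ((hF.contDiffAt_locFun he hz).differentiableAt (by simp))] at h1
  have hy : ((0, z.2) : Coord 2) = z.2 0 • tanJ 2 (dx 0) + z.2 1 • tanJ 2 (dx 1) := by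
    refine Prod.ext (by simp) ?_
    ext i
    fin_cases i <;> simp [dx]
  rw [hy, map_add, map_smul, map_smul] at hE
  simp only [localRicci, jacobiComp, h1, Fin.sum_univ_two, smul_apply, sub_apply,
    ContinuousLinearMap.smulRight_apply, Prod.smul_snd, Prod.snd_sub, PiLp.smul_apply,
    PiLp.sub_apply, liouville, dFun, ContinuousLinearMap.comp_apply, smul_eq_mul] at hE ⊢
  have k0 : (tanJ 2 (dx 0)).2 0 = 1 := by simp [dx]
  have k1 : (tanJ 2 (dx 1)).2 1 = 1 := by simp [dx]
  rw [k0, k1]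
  linear_combination (- κ / 2) * hE

/-- Comparing the two expressions of `Φ`, with `R = κ F²`, gives `α = (κ/2) d_J F²`; this is
`d_J`-closed. The geodesic equation makes `F²`, hence `R`, horizontally constant. -/
theorem MetrizableNonzeroConstant.dJClosed_and_ricciConstant (hS : IsSpray S)
    (hα : IsIsotropicWith S α) (h : MetrizableNonzeroConstant S) :
    DJClosed α ∧ RicciConstant S := by
  obtain ⟨F, hF, hG, κ, -, hκ⟩ := h
  have hL : ∀ e ∈ smoothCharts 2 M, ∀ w ∈ slitDomain e,
      ContDiffAt ℝ ∞ (fun w => locFun e F w ^ 2) w :=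
    fun e he w hw => (hF.contDiffAt_locFun he hw).pow 2
  constructor
  · rw [dJClosed_iff hα hS]
    intro e he z hz ξ η
    refine dForm_tanJ_dFun_tanJ (hL e he z hz) (κ / 2) ?_ ξ η
    filter_upwards [(isOpen_slitDomain e).mem_nhds hz] with w hw
    have h1 := hκ e he w hw
    rw [smul_dFun_eq_half_dFun_sq ((hF.contDiffAt_locFun he hw).differentiableAt (by simp)),
      (hS.isLocalSpray he).jacobiEnd_eq hw, hκ.localRicci_eq hF he hw, smul_sub, smul_smul,
      sub_right_inj] at h1
    refine ContinuousLinearMap.ext fun u => ?_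
    refine smul_left_injective ℝ (liouville_ne_zero (V := e.target) hw) ?_
    have h2 := congrArg (fun L => L u) h1
    simp only [ContinuousLinearMap.smulRight_apply, smul_apply, smul_smul] at h2
    simp only [h2, smul_apply, smul_eq_mul]
    congr 1
    ring
  · intro e he z hz
    have h1 : locFun e (ricciScalar S) =ᶠ[nhds z] fun w => κ * locFun e F w ^ 2 := by
      filter_upwards [(isOpen_slitDomain e).mem_nhds hz] with w hw
      rw [ricciScalar_eq, locFun_ricciCurvature hS he hw, hκ.localRicci_eq hF he hw]
    have h2 := (hS.isLocalSpray he).dFun_horProj_eq_zero hz (hL e he)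
      (fun w hw => hF.fderiv_sq_liouville he hw) (hG e he)
    have h3 := (((hL e he z hz).differentiableAt (by simp)).hasFDerivAt.const_mul κ).fderiv
    rw [dFun_congr h1, dFun, h3, ContinuousLinearMap.smul_comp]
    rw [dFun] at h2
    rw [h2, smul_zero]

open Classical in
/-- The function `√|Ric|`, extended by zero to the zero section. -/
def ricciNorm (S : VField 2 M) (p : TangentBundle (𝓡 2) M) : ℝ :=
  if p.2 = 0 then 0 else √|ricciCurvature S p|

end Surface

/-! ### Sufficiency: `√|Ric|` is the Finsler function. -/

section Metrizability

variable {M : Type*} [TopologicalSpace M] [ChartedSpace (Euc 2) M]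
  [IsManifold (𝓡 2) ∞ M] {e : OpenPartialHomeomorph M (Euc 2)} {S : VField 2 M}
  {α : OneForm 2 M} {z : Coord 2} {ε : ℝ}

theorem dFun_const_mul {n : ℕ} (c : ℝ) (f : Coord n → ℝ) (K : Coord n → Coord n →L[ℝ] Coord n)
    (z : Coord n) : dFun K (fun w => c * f w) z = c • dFun K f z := by
  have h : fderiv ℝ (fun w => c * f w) = c • fderiv ℝ f := fderiv_const_smul_field c
  rw [dFun, dFun, h, Pi.smul_apply, ContinuousLinearMap.smul_comp]

theorem ricciNorm_of_mem {p : TangentBundle (𝓡 2) M} (hp : p ∈ slitTangent 2 M) :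
    ricciNorm S p = √|ricciCurvature S p| :=
  if_neg hp

theorem abs_ricciCurvature (hε : ε * ε = 1)
    (hpos : ∀ p ∈ slitTangent 2 M, 0 < ε * ricciCurvature S p) {p : TangentBundle (𝓡 2) M}
    (hp : p ∈ slitTangent 2 M) : |ricciCurvature S p| = ε * ricciCurvature S p := by
  have h1 : |ε| = 1 := by
    rcases mul_self_eq_one_iff.1 hε with h | h <;> simp [h]
  rw [← abs_of_pos (hpos p hp), abs_mul, h1, one_mul]

theorem locFun_ricciNorm (hS : IsSpray S) (hε : ε * ε = 1)
    (hpos : ∀ p ∈ slitTangent 2 M, 0 < ε * ricciCurvature S p) (he : e ∈ smoothCharts 2 M)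
    (hz : z ∈ slitDomain e) :
    0 < ε * localRicci (locField e S) z ∧
      locFun e (ricciNorm S) z = √(ε * localRicci (locField e S) z) := by
  have hp : (tpoint e z : TangentBundle (𝓡 2) M) ∈ slitTangent 2 M := tpoint_mem_slitTangent he hz
  rw [← locFun_ricciCurvature hS he hz, locFun, locFun, ricciNorm_of_mem hp,
    abs_ricciCurvature hε hpos hp]
  exact ⟨hpos _ hp, rfl⟩

theorem contDiffAt_locFun_ricciNorm (hS : IsSpray S) (hε : ε * ε = 1)
    (hpos : ∀ p ∈ slitTangent 2 M, 0 < ε * ricciCurvature S p) (he : e ∈ smoothCharts 2 M)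
    (hz : z ∈ slitDomain e) : ContDiffAt ℝ ∞ (locFun e (ricciNorm S)) z := by
  have h1 : ContDiffAt ℝ ∞ (fun w => √(ε * localRicci (locField e S) w)) z :=
    (contDiffAt_const.mul ((hS.isLocalSpray he).contDiffAt_localRicci hz)).sqrt
      (locFun_ricciNorm hS hε hpos he hz).1.ne'
  refine h1.congr_of_eventuallyEq ?_
  filter_upwards [(isOpen_slitDomain e).mem_nhds hz] with w hw
    using (locFun_ricciNorm hS hε hpos he hw).2

theorem locFun_ricciNorm_sq (hS : IsSpray S) (hε : ε * ε = 1)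
    (hpos : ∀ p ∈ slitTangent 2 M, 0 < ε * ricciCurvature S p) (he : e ∈ smoothCharts 2 M)
    (hz : z ∈ slitDomain e) :
    locFun e (ricciNorm S) z ^ 2 = ε * localRicci (locField e S) z := by
  obtain ⟨h1, h2⟩ := locFun_ricciNorm hS hε hpos he hz
  rw [h2, Real.sq_sqrt h1.le]

theorem ricciNorm_smul (hS : IsSpray S) (x : M) (y : TangentSpace (𝓡 2) x) (c : ℝ) (hc : 0 ≤ c) :
    ricciNorm S ⟨x, c • y⟩ = c * ricciNorm S ⟨x, y⟩ := by
  rcases hc.eq_or_lt with rfl | hc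
  · simp [ricciNorm]
  · by_cases hy : y = 0
    · subst hy
      simp [ricciNorm]
    · have hcy : c • y ≠ 0 := smul_ne_zero hc.ne' hy
      have hp : (⟨x, y⟩ : TangentBundle (𝓡 2) M) ∈ slitTangent 2 M := hy
      have hp' : (⟨x, c • y⟩ : TangentBundle (𝓡 2) M) ∈ slitTangent 2 M := hcy
      have he := chartAt_mem_smoothCharts (n := 2) x
      have h1 : ricciCurvature S ⟨x, c • y⟩ = c ^ 2 * ricciCurvature S ⟨x, y⟩ := by
        have h2 := (hS.isLocalSpray he).localRicci_scaling
          (tcoord_mem_slitDomain he (p := ⟨x, y⟩) (mem_chart_source _ x) hp) hc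
        rw [scaling_apply, ← tcoord_smul] at h2
        exact h2
      rw [ricciNorm_of_mem hp, ricciNorm_of_mem hp', h1, abs_mul, abs_of_nonneg (sq_nonneg c),
        Real.sqrt_mul (sq_nonneg c), Real.sqrt_sq hc.le]

theorem continuous_ricciNorm (hS : IsSpray S) (hε : ε * ε = 1)
    (hpos : ∀ p ∈ slitTangent 2 M, 0 < ε * ricciCurvature S p) :
    Continuous (ricciNorm S) := by
  rw [continuous_iff_continuousAt]
  intro p
  have he := chartAt_mem_smoothCharts (n := 2) p.1
  have hp : p.1 ∈ (chartAt (Euc 2) p.1).source := mem_chart_source _ _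
  refine continuousAt_of_locFun he hp ?_
  by_cases h0 : p.2 = 0
  -- On the zero section the square root need not be smooth; homogeneity alone gives continuity.
  · have h1 : tcoord (chartAt (Euc 2) p.1) p = (chartAt (Euc 2) p.1 p.1, 0) :=
      Prod.ext rfl ((tcoord_snd_eq_zero_iff he hp).2 h0)
    rw [h1]
    refine continuousAt_zero_of_homogeneous (chartAt (Euc 2) p.1).open_target
      (fun w hw => (contDiffAt_locFun_ricciNorm hS hε hpos he hw).continuousAt.continuousWithinAt)
      (fun x _ y c hc => ?_) ((chartAt (Euc 2) p.1).map_source hp)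
    simp only [locFun]
    rw [tpoint_smul _ (x, y) c]
    exact ricciNorm_smul hS _ _ c hc
  · exact (contDiffAt_locFun_ricciNorm hS hε hpos he (tcoord_mem_slitDomain he hp h0)).continuousAt

/-- Regularity comes from `F² = ε Ric`: then `d d_J F² = ε d d_J Ric` has the rank given by
condition (A). -/
theorem isFinsler_ricciNorm (hS : IsSpray S) (hA : ConditionA S) (hε : ε * ε = 1)
    (hpos : ∀ p ∈ slitTangent 2 M, 0 < ε * ricciCurvature S p) : IsFinsler (ricciNorm S) where
  continuous := continuous_ricciNorm hS hε hpos
  smooth := contMDiffOn_slitTangent fun e he z hz =>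
    (contDiffAt_locFun_ricciNorm hS hε hpos he hz).contDiffWithinAt
  pos := fun p hp => by
    rw [ricciNorm_of_mem hp, abs_ricciCurvature hε hpos hp]
    exact Real.sqrt_pos.2 (hpos p hp)
  homogeneous := ricciNorm_smul hS
  regular := fun e he z hz => by
    refine rank_metricTensor (V := e.target) hz
      (fun w hw => (contDiffAt_locFun_ricciNorm hS hε hpos he hw).pow 2) ?_
    rw [← hA e he z hz]
    have hε0 : ε ≠ 0 := fun h => by simp [h] at hε
    have h1 : ∀ w ∈ slitDomain e,
        dFun (fun _ => tanJ 2) (fun w => locFun e (ricciNorm S) w ^ 2) w =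
          ε • dFun (fun _ => tanJ 2) (locFun e (ricciCurvature S)) w := by
      intro w hw
      have h2 : (fun w => locFun e (ricciNorm S) w ^ 2) =ᶠ[nhds w]
          fun w => ε * locFun e (ricciCurvature S) w := by
        filter_upwards [(isOpen_slitDomain e).mem_nhds hw] with v hv
        rw [locFun_ricciNorm_sq hS hε hpos he hv, locFun_ricciCurvature hS he hv]
      rw [dFun_congr h2, dFun_const_mul]
    have h3 : fderiv ℝ (dFun (fun _ => tanJ 2) (fun w => locFun e (ricciNorm S) w ^ 2)) z =
        ε • fderiv ℝ (dFun (fun _ => tanJ 2) (locFun e (ricciCurvature S))) z := by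
      rw [← Pi.smul_apply, ← fderiv_const_smul_field]
      refine Filter.EventuallyEq.fderiv_eq ?_
      filter_upwards [(isOpen_slitDomain e).mem_nhds hz] with w hw using h1 w hw
    have h4 : extD (dFun (fun _ => tanJ 2) (fun w => locFun e (ricciNorm S) w ^ 2)) z =
        ε • extD (dFun (fun _ => tanJ 2) (locFun e (ricciCurvature S))) z := by
      rw [extD, extD, h3]
      refine ContinuousLinearMap.ext fun ξ => ContinuousLinearMap.ext fun η => ?_
      simp [mul_sub]
    rw [h4, formRank, formRank]
    exact congrArg (fun P : Submodule ℝ (Coord 2 →L[ℝ] ℝ) => Module.finrank ℝ P)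
      (LinearMap.range_smul _ ε hε0)

theorem metrizableNonzeroConstant_of_dJClosed [ConnectedSpace M] (hS : IsSpray S)
    (hRic : ∀ p ∈ slitTangent 2 M, ricciCurvature S p ≠ 0) (hA : ConditionA S)
    (hα : IsIsotropicWith S α) (hJ : DJClosed α) (hH : RicciConstant S) :
    MetrizableNonzeroConstant S := by
  obtain ⟨ε, hε, hpos⟩ := exists_sign (f := ricciCurvature S) one_lt_two
    (fun e he => ContinuousOn.congr (f := localRicci (locField e S))
      (fun z hz => ((hS.isLocalSpray he).contDiffAt_localRicci hz).continuousAt.continuousWithinAt)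
      (fun z hz => locFun_ricciCurvature hS he hz)) hRic
  have hF := isFinsler_ricciNorm hS hA hε hpos
  have hε0 : ε ≠ 0 := fun h => by simp [h] at hε
  have hsq : ∀ e ∈ smoothCharts 2 M, ∀ z ∈ slitDomain e,
      (fun w => locFun e (ricciNorm S) w ^ 2) =ᶠ[nhds z]
        fun w => ε * localRicci (locField e S) w := by
    intro e he z hz
    filter_upwards [(isOpen_slitDomain e).mem_nhds hz] with w hw
      using locFun_ricciNorm_sq hS hε hpos he hw
  rw [dJClosed_iff hα hS] at hJ
  -- The curvature is the sign `ε`, because `F² = ε R` and `ε² = 1` give `R = ε F²`.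
  refine ⟨ricciNorm S, hF, fun e he z hz => ?_, ε, hε0, fun e he z hz => ?_⟩
  · refine (hS.isLocalSpray he).extD_dFun_tanJ_spray hz
      (fun w hw => (hF.contDiffAt_locFun he hw).pow 2)
      (fun w hw => hF.fderiv_sq_liouville he hw) fun w hw => ?_
    have h1 := hH e he w hw
    rw [dFun_congr (locFun_ricciScalar_eventuallyEq hS he hw), dFun] at h1
    rw [dFun_congr (hsq e he w hw), dFun_const_mul, dFun, h1, smul_zero]
  · rw [smul_dFun_eq_half_dFun_sq ((hF.contDiffAt_locFun he hz).differentiableAt (by simp)),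
      (hS.isLocalSpray he).jacobiEnd_eq hz, locFun_ricciNorm_sq hS hε hpos he hz,
      dFun_congr (hsq e he z hz), dFun_const_mul, dFun]
    -- With `d_J R = 2 α` one gets `F d_J F = ½ ε d_J R = ε α`, and the factor `κ = ε` turns this
    -- into `α`.
    have h1 := (hS.isLocalSpray he).fderiv_localRicci_tanJ hz (hJ e he z hz)
    refine ContinuousLinearMap.ext fun ξ => ?_
    simp only [sub_apply, smul_apply, ContinuousLinearMap.smulRight_apply,
      ContinuousLinearMap.comp_apply, h1, smul_sub, smul_smul, smul_eq_mul]
    congr 2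
    · linear_combination (- localRicci (locField e S) z) * hε
    · linear_combination (- localIsoForm (locField e S) z ξ) * hε

end Metrizability

end SprayGeometry

end

open SprayGeometry
theorem theorem4p3 {M : Type*} [TopologicalSpace M] [ChartedSpace (EuclideanSpace ℝ (Fin 2)) M]
    [IsManifold (𝓡 2) ∞ M] [ConnectedSpace M]
    (S : VField 2 M) (hS : IsSpray S)
    (hRic : ∀ p ∈ slitTangent 2 M, ricciCurvature S p ≠ 0)
    (hA : ConditionA S) :
    IsIsotropic S ∧
    ∀ α : OneForm 2 M, IsIsotropicWith S α →
      (∀ e ∈ smoothCharts 2 M, ∀ z ∈ slitDomain e,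
        (z.2 0 ≠ 0 →
          locForm e α z (dx 0) = jacobiComp (locField e S) z 1 1 / z.2 0 ∧
          locForm e α z (dx 1) = - jacobiComp (locField e S) z 0 1 / z.2 0) ∧
        (z.2 1 ≠ 0 →
          locForm e α z (dx 0) = - jacobiComp (locField e S) z 1 0 / z.2 1 ∧
          locForm e α z (dx 1) = jacobiComp (locField e S) z 0 0 / z.2 1)) ∧
      (MetrizableNonzeroConstant S ↔ DJClosed α ∧ RicciConstant S) :=
  ⟨⟨isoForm S, isIsotropicWith_isoForm hS⟩, fun _ hα =>
    ⟨fun _ he _ hz => hα.components hS he hz,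
      fun h => h.dJClosed_and_ricciConstant hS hα,
      fun h => metrizableNonzeroConstant_of_dJClosed hS hRic hA hα h.1 h.2⟩⟩
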